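/- Let $G$ be a homogeneous group, i.e. a nilpotent Lie group whose underlying manifold is a finite-dimensional real vector space, identified with its Lie algebra $\mathfrak g$ by the exponential map, where $\mathfrak g=\mathfrak g^1\oplus\cdots\oplus\mathfrak g^r$ is graded, $[\mathfrak g^j,\mathfrak g^k]\subseteq\mathfrak g^{j+k}$ (with $\mathfrak g^{j+k}=0$ if $j+k>r$). Let $\delta_t$ ($t>0$) be the dilations, $\delta_t=t^j$ on $\mathfrak g^j$, and let $Q=\sum_j j\dim\mathfrak g^j$. Functions on $G$ are regarded as distributions by means of a fixed Haar measure $\mu$. A complex distribution $u$ on $G$ is called regular if it is smooth on $G\setminus\{0\}$, and homogeneous of degree $d$ if $\langle u,\psi\circ\delta_t\rangle=t^{-Q-d}\langle u,\psi\rangle$ for all $t>0$ and all test functions $\psi$. Let $\mathcal S_H(G)$ be the complex vector space of regular distributions on $G$ that are homogeneous of degree $-Q$. A compactly supported regular distribution $k$ has the asymptotic expansion $k\sim k_0+k_1+k_2+\cdots$ with principal part $k_0$ if each $k_j$ is regular and homogeneous of degree $-Q+j$ (for $j\ge Q$: homogeneous up to logarithms, i.e. $k_j\circ\delta_t=t^{-Q+j}(k_j+\log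 t\cdot p_j)$ for all $t>0$, with $p_j$ a polynomial homogeneous of degree $-Q+j$), and if for every $M$ the remainder $k-\sum_{j<N}k_j$ is a $C^M$ function for all sufficiently large $N$. The product $f*g$ of $f,g\in\mathcal S_H(G)$ is the principal part of the convolution $\phi f*\phi g$ on $G$, where $\phi\in C_c^\infty(G)$ is equal to $1$ in a neighborhood of $0$. Then this product is a well-defined bilinear map $\mathcal S_H(G)\times\mathcal S_H(G)\to\mathcal S_H(G)$: for every such $\phi$ the convolution $\phi f*\phi g$ is a compactly supported regular distribution with an asymptotic expansion as above, and its principal part is unique, independent of $\phi$, and belongs to $\mathcal S_H(G)$. If $z\neq0$ is a central element of $G$, then $$\tau_z:\mathcal S_H(G)\to\mathbb C,\qquad \tau_z(f):=f(z)$$ (the value at $z$ of the smooth function that represents $f$ on $G\setminus\{0\}$) is a trace on $\mathcal S_H(G)$: it is linear, and $\tau_z(f*g)=\tau_z(g*f)$ for all $f,g\in\mathcal S_H(G)$. (The well-definedness of the product is asserted here for groups with a nonzero central element, i.e. for $\mathfrak g\ne0$.) -/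

import Mathlib

open MeasureTheory Set Filter Topology TopologicalSpace
open scoped ContDiff Distributions

noncomputable section

/-- A homogeneous (graded nilpotent) Lie group, in exponential coordinates: a Lie group structure
on a finite-dimensional real vector space `V` such that the exponential map is the identity map
of `V`, together with a grading `V = V¹ ⊕ ⋯ ⊕ Vʳ` of its Lie algebra. The Lie algebra is the
tangent space `V` at the identity `0`, with the Lie bracket of left-invariant vector fields. -/
structure HomogeneousGroup (V : Type*) [NormedAddCommGroup V] [NormedSpace ℝ V] where
  /-- The group multiplication. -/
  mul : V → V → V
  contDiff_mul : ContDiff ℝ ∞ (fun p : V × V => mul p.1 p.2)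
  mul_assoc : ∀ x y w : V, mul (mul x y) w = mul x (mul y w)
  /-- Every line `t ↦ t x` is a one-parameter subgroup, i.e. `exp x = x`. In particular `0` is the
  identity element, and `-x` is the inverse of `x`. -/
  smul_mul_smul : ∀ (s t : ℝ) (x : V), mul (s • x) (t • x) = (s + t) • x
  /-- The number `r` of layers. -/
  step : ℕ
  /-- The layers `Vʲ`, which are zero unless `1 ≤ j ≤ r`. -/
  grade : ℕ → Submodule ℝ V
  grade_eq_bot : ∀ j, j = 0 ∨ step < j → grade j = ⊥
  isInternal : DirectSum.IsInternal grade
  /-- `[Vʲ, Vᵏ] ⊆ Vʲ⁺ᵏ`, where `Vʲ⁺ᵏ = 0` if `j + k > r`. -/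
  lie_mem : ∀ (j k : ℕ) (x y : V), x ∈ grade j → y ∈ grade k →
    VectorField.lieBracket ℝ
      (fun p => fderiv ℝ (fun w => mul p w) 0 x)
      (fun p => fderiv ℝ (fun w => mul p w) 0 y) 0 ∈ grade (j + k)

/-- Test functions `C_c^∞(V, ℂ)`. -/
abbrev TestFn (V : Type*) [NormedAddCommGroup V] [NormedSpace ℝ V] : Type _ :=
  𝓓((⊤ : Opens V), ℂ)

/-- Complex distributions on `V`. -/
abbrev Distr (V : Type*) [NormedAddCommGroup V] [NormedSpace ℝ V] : Type _ :=
  TestFn V →L[ℂ] ℂ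

namespace Distr

variable {V : Type*} [NormedAddCommGroup V] [NormedSpace ℝ V]

/-- Multiplication `ψ ↦ φ ψ` of test functions by a test function `φ`. -/
def testMul (φ : TestFn V) : TestFn V →L[ℂ] TestFn V :=
  TestFunction.limitCLM ℂ
    (fun ψ => ⟨fun x => φ x * ψ x, φ.contDiff.mul ψ.contDiff,
      ψ.hasCompactSupport.mul_left, fun _ _ => trivial⟩)
    (fun _ hK => (TestFunction.ofSupportedInCLM ℂ hK).comp
      (ContDiffMapSupportedIn.bilinLeftCLM (ContinuousLinearMap.mul ℂ ℂ) φ.contDiff))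
    (fun K hK ψ => by
      ext x
      exact mul_comm _ _)

/-- The product `φ u` of a distribution with a test function: `⟨φ u, ψ⟩ = ⟨u, φ ψ⟩`. -/
def cutoff (φ : TestFn V) (u : Distr V) : Distr V :=
  u.comp (testMul φ)

theorem cutoff_apply (φ : TestFn V) (u : Distr V) (ψ : TestFn V) :
    cutoff φ u ψ = u (testMul φ ψ) := rfl

theorem testMul_apply (φ ψ : TestFn V) (x : V) : testMul φ ψ x = φ x * ψ x := rfl

/-- `u` has compact support. -/
def IsCompactlySupported (u : Distr V) : Prop :=
  ∃ K : Set V, IsCompact K ∧ ∀ ψ : TestFn V, tsupport ψ ⊆ Kᶜ → u ψ = 0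

/-- The restriction of `u` to `V \ {0}` is given by the function `F`, smooth on `V \ {0}`. -/
def RepresentedBy [MeasurableSpace V] (μ : Measure V) (u : Distr V) (F : V → ℂ) : Prop :=
  ContDiffOn ℝ ∞ F {0}ᶜ ∧
    ∀ ψ : TestFn V, tsupport ψ ⊆ {0}ᶜ → u ψ = ∫ x, F x * ψ x ∂μ

/-- Regular distributions: those which are smooth on `V \ {0}`. -/
def IsRegular [MeasurableSpace V] (μ : Measure V) (u : Distr V) : Prop :=
  ∃ F : V → ℂ, RepresentedBy μ u F

end Distr

namespace HomogeneousGroup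

variable {V : Type*} [NormedAddCommGroup V] [NormedSpace ℝ V] (G : HomogeneousGroup V)

theorem zero_mul (x : V) : G.mul 0 x = x := by
  simpa using G.smul_mul_smul 0 1 x

theorem mul_zero (x : V) : G.mul x 0 = x := by
  simpa using G.smul_mul_smul 1 0 x

theorem mul_neg (x : V) : G.mul x (-x) = 0 := by
  simpa using G.smul_mul_smul 1 (-1) x

theorem neg_mul (x : V) : G.mul (-x) x = 0 := by
  simpa using G.smul_mul_smul (-1) 1 x

/-- `z` is a central element of the group. -/
def IsCentral (z : V) : Prop := ∀ x : V, G.mul z x = G.mul x z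

/-- The homogeneous dimension `Q = ∑ j dim Vʲ`. -/
def homDim : ℕ := ∑ j ∈ Finset.range (G.step + 1), j * Module.finrank ℝ (G.grade j)

/-- The identification of `⨁ Vʲ` with `V`. -/
def gradeEquiv : (DirectSum ℕ fun j => G.grade j) ≃ₗ[ℝ] V :=
  LinearEquiv.ofBijective (DirectSum.coeLinearMap G.grade) G.isInternal

/-- The dilation `δ_t`, which is multiplication by `tʲ` on `Vʲ`. -/
def dilation (t : ℝ) : V →ₗ[ℝ] V :=
  G.gradeEquiv.toLinearMap ∘ₗ
    DFinsupp.mapRange.linearMap (fun j => (t ^ j) • (LinearMap.id : G.grade j →ₗ[ℝ] G.grade j)) ∘ₗ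
      G.gradeEquiv.symm.toLinearMap

theorem dilation_apply_of_mem (t : ℝ) (j : ℕ) (x : V) (hx : x ∈ G.grade j) :
    G.dilation t x = t ^ j • x := by
  have h : G.gradeEquiv.symm x = DirectSum.lof ℝ ℕ (fun j => G.grade j) j ⟨x, hx⟩ := by
    rw [LinearEquiv.symm_apply_eq]
    exact (DirectSum.coeLinearMap_lof G.grade j ⟨x, hx⟩).symm
  have h2 : DFinsupp.mapRange.linearMap
      (fun j => (t ^ j) • (LinearMap.id : G.grade j →ₗ[ℝ] G.grade j))
      (DirectSum.lof ℝ ℕ (fun j => G.grade j) j ⟨x, hx⟩)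
      = t ^ j • DirectSum.lof ℝ ℕ (fun j => G.grade j) j ⟨x, hx⟩ := by
    rw [← map_smul]
    exact DFinsupp.mapRange_single (hf := fun i => map_zero _)
  simp only [dilation, LinearMap.comp_apply, LinearEquiv.coe_coe, h, h2, map_smul]
  rw [← h, LinearEquiv.apply_symm_apply]

theorem dilation_injective {t : ℝ} (ht : 0 < t) : Function.Injective (G.dilation t) := by
  have h : Function.Injective (DFinsupp.mapRange.linearMap
      (fun j => (t ^ j) • (LinearMap.id : G.grade j →ₗ[ℝ] G.grade j))) := by
    intro a b hab
    refine DFinsupp.ext fun j => ?_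
    have := DFunLike.congr_fun hab j
    simpa [(pow_pos ht j).ne'] using this
  exact G.gradeEquiv.injective.comp (h.comp G.gradeEquiv.symm.injective)

/-- The test function `ψ ∘ δ_t`. -/
def compDilation [FiniteDimensional ℝ V] (ψ : TestFn V) {t : ℝ} (ht : 0 < t) : TestFn V :=
  ⟨fun x => ψ (G.dilation t x),
    ψ.contDiff.comp (G.dilation t).toContinuousLinearMap.contDiff,
    ψ.hasCompactSupport.comp_isClosedEmbedding
      ((G.dilation t).isClosedEmbedding_of_injective
        (LinearMap.ker_eq_bot.2 (G.dilation_injective ht))),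
    fun _ _ => trivial⟩

/-- Left translation by `x`, as a homeomorphism. -/
def leftMul (x : V) : V ≃ₜ V where
  toFun y := G.mul x y
  invFun y := G.mul (-x) y
  left_inv y := by
    change G.mul (-x) (G.mul x y) = y
    rw [← G.mul_assoc, neg_mul, zero_mul]
  right_inv y := by
    change G.mul x (G.mul (-x) y) = y
    rw [← G.mul_assoc, mul_neg, zero_mul]
  continuous_toFun := G.contDiff_mul.continuous.comp (Continuous.prodMk_right x)
  continuous_invFun := G.contDiff_mul.continuous.comp (Continuous.prodMk_right (-x))

/-- The test function `y ↦ ψ (x y)`. -/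
def leftTranslate (x : V) (ψ : TestFn V) : TestFn V :=
  ⟨fun y => ψ (G.mul x y),
    ψ.contDiff.comp (G.contDiff_mul.comp (contDiff_prodMk_right x)),
    ψ.hasCompactSupport.comp_homeomorph (G.leftMul x),
    fun _ _ => trivial⟩

/-- `w = u * v`, the convolution on the group: for all test functions `ψ`,
`⟨w, ψ⟩ = ⟨u_x, ⟨v_y, ψ(x y)⟩⟩`, where `x ↦ ⟨v_y, ψ(x y)⟩` is a test function. -/
def IsConvolution (u v w : Distr V) : Prop :=
  ∀ ψ : TestFn V, ∃ F : TestFn V, (∀ x, F x = v (G.leftTranslate x ψ)) ∧ w ψ = u F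

section

variable [FiniteDimensional ℝ V]

/-- `u` is homogeneous of degree `d`: `⟨u, ψ ∘ δ_t⟩ = t ^ (-Q-d) ⟨u, ψ⟩` for all `t > 0`. -/
def IsHomogeneous (d : ℤ) (u : Distr V) : Prop :=
  ∀ (t : ℝ) (ht : 0 < t) (ψ : TestFn V),
    u (G.compDilation ψ ht) = (t : ℂ) ^ (-(G.homDim : ℤ) - d) * u ψ

variable [MeasurableSpace V] [BorelSpace V] (μ : Measure V) [μ.IsAddHaarMeasure]

/-- The admissible terms of degree `d` in an asymptotic expansion: regular distributions `u` with
`u ∘ δ_t = t ^ d (u + (log t) p)` for all `t > 0`, for some smooth function `p` on `V`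
homogeneous of degree `d` (hence `p` is a homogeneous polynomial, and `p = 0` if `d < 0`, in which
case `u` is homogeneous of degree `d`). The equation is written with `δ_t` acting on test
functions, and the sign is absorbed in `p`. -/
def IsLogHomogeneous (d : ℤ) (u : Distr V) : Prop :=
  u.IsRegular μ ∧ ∃ p : V → ℂ, ContDiff ℝ ∞ p ∧
    (∀ t : ℝ, 0 < t → ∀ x, p (G.dilation t x) = (t : ℂ) ^ d * p x) ∧
    ∀ (t : ℝ) (ht : 0 < t) (ψ : TestFn V),
      u (G.compDilation ψ ht) =
        (t : ℂ) ^ (-(G.homDim : ℤ) - d) * (u ψ + (Real.log t : ℂ) * ∫ x, p x * ψ x ∂μ)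

/-- The asymptotic expansion `k ∼ k₀ + k₁ + k₂ + ⋯`, with `k_j` of degree `-Q + j`: for every `M`,
the remainder `k - ∑_{j < N} k_j` is a function of class `C^M` for all sufficiently large `N`. -/
def HasAsymptoticExpansion (k : Distr V) (a : ℕ → Distr V) : Prop :=
  (∀ j : ℕ, G.IsLogHomogeneous μ (-(G.homDim : ℤ) + j) (a j)) ∧
  ∀ M : ℕ, ∃ N₀ : ℕ, ∀ N ≥ N₀, ∃ r : V → ℂ, ContDiff ℝ M r ∧
    ∀ ψ : TestFn V, k ψ - ∑ j ∈ Finset.range N, a j ψ = ∫ x, r x * ψ x ∂μ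

/-- `k` is the convolution kernel of an operator in `Ψ⁰_H(G)` (a compactly supported regular
distribution with an asymptotic expansion), and its principal term is `k₀`. -/
def HasPrincipalPart (k k₀ : Distr V) : Prop :=
  k.IsCompactlySupported ∧ k.IsRegular μ ∧
    ∃ a : ℕ → Distr V, a 0 = k₀ ∧ G.HasAsymptoticExpansion μ k a

/-- The space `𝒮_H(G)` of principal symbols: the regular distributions on `G` that are homogeneous
of degree `-Q`. -/
def symbolSpace : Submodule ℂ (Distr V) where
  carrier := {u | u.IsRegular μ ∧ G.IsHomogeneous (-(G.homDim : ℤ)) u}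
  zero_mem' := by
    refine ⟨⟨fun _ => 0, contDiffOn_const, fun ψ _ => ?_⟩, fun t ht ψ => ?_⟩ <;> simp
  add_mem' := by
    rintro u v ⟨⟨F, hF, huF⟩, hu⟩ ⟨⟨F', hF', hvF'⟩, hv⟩
    refine ⟨⟨fun x => F x + F' x, hF.add hF', fun ψ hψ => ?_⟩, fun t ht ψ => ?_⟩
    · have key : ∀ F : V → ℂ, ContDiffOn ℝ ∞ F {0}ᶜ → Integrable (fun x => F x * ψ x) μ := by
        intro F hF
        have := TestFunction.integrable_bilin (Ω := ⟨{0}ᶜ, isOpen_compl_singleton⟩)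
          (ContinuousLinearMap.mul ℂ ℂ) (μ := μ) (φ := F)
          (hF.continuousOn.locallyIntegrableOn isOpen_compl_singleton.measurableSet)
          ⟨ψ, ψ.contDiff, ψ.hasCompactSupport, hψ⟩
        simpa [mul_comm] using this
      rw [_root_.add_apply, huF ψ hψ, hvF' ψ hψ,
        ← integral_add (key F hF) (key F' hF')]
      simp only [add_mul]
    · rw [_root_.add_apply, hu t ht, hv t ht, _root_.add_apply, mul_add]
  smul_mem' := by
    rintro c u ⟨⟨F, hF, huF⟩, hu⟩
    refine ⟨⟨fun x => c * F x, contDiffOn_const.mul hF, fun ψ hψ => ?_⟩, fun t ht ψ => ?_⟩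
    · rw [_root_.smul_apply, huF ψ hψ, smul_eq_mul, ← integral_const_mul]
      simp only [_root_.mul_assoc]
    · rw [_root_.smul_apply, hu t ht, _root_.smul_apply,
        smul_eq_mul, smul_eq_mul, mul_left_comm]

/-- `h` is the product of the principal symbols `f` and `g`, computed by means of `φ`: the
convolution `φ f * φ g` belongs to `Ψ⁰_H(G)`, and `h` is its principal part. -/
def IsSymbolProduct (φ : TestFn V) (f g h : Distr V) : Prop :=
  ∃ k : Distr V, G.IsConvolution (Distr.cutoff φ f) (Distr.cutoff φ g) k ∧
    G.HasPrincipalPart μ k h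

end

end HomogeneousGroup

end

/-! Homogeneity of degree `-Q` means invariance: `u (ψ ∘ δ_t) = u ψ`. For a symbol `f` and a cutoff
`φ`, the distribution `(φ - φ ∘ δ_t) f` is a test function, because the cutoff vanishes near 0,
while `(φ ∘ δ_t) f` paired with a smooth `g` is `φ f` paired with `g ∘ δ_{1/t}`, which tends to
`f(φ) g(0)` as `t → ∞`. So `φ f` is a test function plus something close to a multiple of the delta
at 0. This yields Fubini (`pair_setIntegral`), smooth dependence on parameters (`contDiff_pair`)
and, with Banach–Steinhaus, the existence of `φ f * φ g` as a distribution (`exists_convolution`).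

Changing the cutoff changes `φ f * φ g` by a test function only (`exists_testFn_convPair_sub`).
Since dilations are group automorphisms (`dilation_mul`), dilating the convolution amounts to
changing the cutoff, so `k = φ f * φ g` is homogeneous of degree `-Q` modulo test functions. A
geometric series then corrects `k` by a smooth function to an exactly homogeneous `h`
(`exists_homogeneous_add_smooth`). Cutoffs with small support show that `k`, hence `h`, is smooth
away from 0. So `k ∼ h + 0 + 0 + ⋯`, and `h` is the only possible principal part: tested on `ψ ∘
δ_t` with `t → ∞`, the terms of degree `-Q` stay constant and all others decay, because `Q > 0`
(`eq_of_hasPrincipalPart`).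

For the trace, cutoffs `φ'` are taken so small that `φ' f * φ' g` vanishes near `z`. Near `z`, `φ f
* φ g` is then a sum of convolutions of a test function with a cut-off symbol. Exchanging the
factors replaces `w(z y⁻¹)` by `w(y⁻¹ z)` in these, which changes nothing for central `z`
(`eq_of_isCentral`). This applies to the full convolutions, including their smooth remainders; the
remainders disappear on passing to `δ_ε z`, which is again central, multiplying by `ε^Q` and letting
`ε → 0` (`IsProductSymbol.apply_eq_of_isCentral`). -/

noncomputable section


/-! ### Lie algebra endomorphisms are group endomorphisms in exponential coordinates. -/

/-- Uniqueness of global integral curves of an autonomous vector field of class `C¹`. -/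
theorem eq_of_hasDerivAt_of_contDiff {E : Type*} [NormedAddCommGroup E] [NormedSpace ℝ E]
    {X : E → E} (hX : ContDiff ℝ 1 X) {f g : ℝ → E} (hf : ∀ t, HasDerivAt f (X (f t)) t)
    (hg : ∀ t, HasDerivAt g (X (g t)) t) (h0 : f 0 = g 0) : f = g := by
  have hfc : Continuous f := continuous_iff_continuousAt.2 fun t => (hf t).continuousAt
  have hgc : Continuous g := continuous_iff_continuousAt.2 fun t => (hg t).continuousAt
  have hclopen : IsClopen {t | f t = g t} := by
    refine ⟨isClosed_eq hfc hgc, isOpen_iff_mem_nhds.2 fun t ht => ?_⟩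
    obtain ⟨K, s, hs, hK⟩ := hX.contDiffAt.exists_lipschitzOnWith (x := f t)
    refine ODE_solution_unique_of_eventually (v := fun _ => X) (s := fun _ => s)
      (Eventually.of_forall fun _ => hK) ?_ ?_ ht
    · filter_upwards [hfc.continuousAt.preimage_mem_nhds hs] with u hu using ⟨hf u, hu⟩
    · filter_upwards [hgc.continuousAt.preimage_mem_nhds (ht ▸ hs)] with u hu using ⟨hg u, hu⟩
  have huniv := hclopen.eq_univ ⟨0, h0⟩
  exact funext fun t => (huniv ▸ mem_univ t : t ∈ {t | f t = g t})

theorem HasFDerivAt.hasDerivAt_comp_prodMk {E E' F : Type*} [NormedAddCommGroup E]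
    [NormedSpace ℝ E] [NormedAddCommGroup E'] [NormedSpace ℝ E'] [NormedAddCommGroup F]
    [NormedSpace ℝ F] {Φ : E × E' → F} {L : E × E' →L[ℝ] F} {f : ℝ → E} {g : ℝ → E'} {f' : E}
    {g' : E'} {p : E × E'} {t : ℝ} (hΦ : HasFDerivAt Φ L p) (hf : HasDerivAt f f' t)
    (hg : HasDerivAt g g' t) (hp : (f t, g t) = p) :
    HasDerivAt (fun t => Φ (f t, g t)) (L (f', g')) t := by
  subst hp
  exact hΦ.comp_hasDerivAt t (hf.prodMk hg)

theorem hasDerivAt_smul_zero {E : Type*} [NormedAddCommGroup E] [NormedSpace ℝ E] (y : E) :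
    HasDerivAt (fun h : ℝ => h • y) y 0 := by
  simpa using (hasDerivAt_id (0 : ℝ)).smul_const y

namespace HomogeneousGroup

variable {V : Type*} [NormedAddCommGroup V] [NormedSpace ℝ V] (G : HomogeneousGroup V)

/-- The uncurried multiplication. -/
def mulProd (p : V × V) : V := G.mul p.1 p.2

theorem contDiff_mulProd : ContDiff ℝ ∞ G.mulProd := G.contDiff_mul

theorem hasFDerivAt_mulProd (p : V × V) : HasFDerivAt G.mulProd (fderiv ℝ G.mulProd p) p :=
  (G.contDiff_mulProd.differentiable (by simp) p).hasFDerivAt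

theorem contDiff_fderiv_mulProd : ContDiff ℝ ∞ (fderiv ℝ G.mulProd) :=
  G.contDiff_mulProd.fderiv_right (by simp)

theorem contDiff_mul_comp {E : Type*} [NormedAddCommGroup E] [NormedSpace ℝ E] {f g : E → V}
    {n : ℕ∞} (hf : ContDiff ℝ n f) (hg : ContDiff ℝ n g) :
    ContDiff ℝ n (fun x => G.mul (f x) (g x)) :=
  (G.contDiff_mul.of_le (by exact_mod_cast le_top)).comp (hf.prodMk hg)

theorem continuous_mul_comp {E : Type*} [TopologicalSpace E] {f g : E → V}
    (hf : Continuous f) (hg : Continuous g) : Continuous (fun x => G.mul (f x) (g x)) :=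
  G.contDiff_mul.continuous.comp (hf.prodMk hg)

/-- The second derivative of the multiplication at the identity. -/
def mulHess : V × V →L[ℝ] V × V →L[ℝ] V := fderiv ℝ (fderiv ℝ G.mulProd) 0

theorem hasFDerivAt_fderiv_mulProd : HasFDerivAt (fderiv ℝ G.mulProd) G.mulHess 0 :=
  (G.contDiff_fderiv_mulProd.differentiable (by simp) 0).hasFDerivAt

theorem mulHess_symm (p q : V × V) : G.mulHess p q = G.mulHess q p :=
  (G.contDiff_mulProd.contDiffAt (x := (0 : V × V))).isSymmSndFDerivAt
    (by simpa using (ENat.LEInfty.out : (2 : ℕ∞ω) ≤ ∞)) p q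

/-- The Lie bracket on the tangent space at the identity. -/
def bracket (x y : V) : V := G.mulHess (x, 0) (0, y) - G.mulHess (y, 0) (0, x)

theorem fderiv_mul_left (p q v : V) :
    fderiv ℝ (fun w => G.mul p w) q v = fderiv ℝ G.mulProd (p, q) (0, v) := by
  have h := (G.hasFDerivAt_mulProd (p, q)).comp q (hasFDerivAt_prodMk_right p q)
  exact congrArg (fun L : V →L[ℝ] V => L v) h.fderiv

theorem fderiv_mulProd_zero_left (q v : V) : fderiv ℝ G.mulProd (0, q) (0, v) = v := by
  rw [← fderiv_mul_left]
  simp [G.zero_mul]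

theorem fderiv_mulProd_zero_right (q v : V) : fderiv ℝ G.mulProd (q, 0) (v, 0) = v := by
  have h := HasFDerivAt.comp (g := G.mulProd) (f := fun p : V => (p, (0 : V))) q
    (G.hasFDerivAt_mulProd (q, 0)) (hasFDerivAt_prodMk_left q (0 : V))
  have h' : HasFDerivAt (G.mulProd ∘ fun e => (e, 0)) (ContinuousLinearMap.id ℝ V) q := by
    have : (G.mulProd ∘ fun e => (e, 0)) = id := funext fun e => G.mul_zero e
    rw [this]
    exact hasFDerivAt_id q
  exact congrArg (fun L : V →L[ℝ] V => L v) (h.unique h')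

theorem lieBracket_eq_bracket (x y : V) :
    VectorField.lieBracket ℝ (fun p => fderiv ℝ (fun w => G.mul p w) 0 x)
      (fun p => fderiv ℝ (fun w => G.mul p w) 0 y) 0 = G.bracket x y := by
  have key : ∀ x y : V, fderiv ℝ (fun p => fderiv ℝ (fun w => G.mul p w) 0 y) 0 x =
      G.mulHess (x, 0) (0, y) := by
    intro x y
    simp only [fderiv_mul_left]
    have h := HasFDerivAt.comp (g := fderiv ℝ G.mulProd) (f := fun p : V => (p, (0 : V))) (0 : V)
      G.hasFDerivAt_fderiv_mulProd (hasFDerivAt_prodMk_left (0 : V) (0 : V))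
    have h2 := h.clm_apply (hasFDerivAt_const ((0 : V), y) (0 : V))
    have h3 := congrArg (fun L : V →L[ℝ] V => L x) h2.fderiv
    simpa using h3
  simp only [VectorField.lieBracket_eq]
  rw [key, key]
  simp only [fderiv_mul_left, fderiv_mulProd_zero_left]
  rfl

/-- The one-parameter subgroups give `c(s + h) = (-h x) · c(s) · (h y)`. Differentiating at `h = 0`
leaves the left-invariant field of `y` minus the right-invariant field of `x`. -/
theorem hasDerivAt_conj (x y : V) (s : ℝ) :
    HasDerivAt (fun s : ℝ => G.mul (-(s • x)) (s • y))
      (fderiv ℝ G.mulProd (G.mul (-(s • x)) (s • y), 0) (0, y) -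
        fderiv ℝ G.mulProd (0, G.mul (-(s • x)) (s • y)) (x, 0)) s := by
  set c := G.mul (-(s • x)) (s • y) with hc
  have h1 : HasDerivAt (fun h : ℝ => G.mulProd (c, h • y)) (fderiv ℝ G.mulProd (c, 0) (0, y)) 0 := by
    exact (G.hasFDerivAt_mulProd (c, 0)).hasDerivAt_comp_prodMk (hasDerivAt_const (0 : ℝ) c)
      (hasDerivAt_smul_zero y) (by simp)
  have h2 : HasDerivAt (fun h : ℝ => G.mulProd (-(h • x), G.mulProd (c, h • y)))
      (fderiv ℝ G.mulProd (0, c) (-x, fderiv ℝ G.mulProd (c, 0) (0, y))) 0 := by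
    exact (G.hasFDerivAt_mulProd (0, c)).hasDerivAt_comp_prodMk (hasDerivAt_smul_zero x).neg h1
      (by simp [mulProd, G.mul_zero])
  have h3 : HasDerivAt (fun s' : ℝ => G.mulProd (-((s' - s) • x), G.mulProd (c, (s' - s) • y)))
      (fderiv ℝ G.mulProd (0, c) (-x, fderiv ℝ G.mulProd (c, 0) (0, y))) s := by
    have h2' := h2
    rw [← sub_self s] at h2'
    exact h2'.comp_sub_const s s
  have e1 : fderiv ℝ G.mulProd (0, c) (-x, fderiv ℝ G.mulProd (c, 0) (0, y)) =
      fderiv ℝ G.mulProd (c, 0) (0, y) - fderiv ℝ G.mulProd (0, c) (x, 0) := by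
    have : ((-x, fderiv ℝ G.mulProd (c, 0) (0, y)) : V × V) =
        (0, fderiv ℝ G.mulProd (c, 0) (0, y)) - (x, 0) := by simp
    rw [this, map_sub, fderiv_mulProd_zero_left]
  rw [← e1]
  refine h3.congr_of_eventuallyEq (Eventually.of_forall fun s' => ?_)
  have a1 : s' • y = G.mul (s • y) ((s' - s) • y) := by
    rw [G.smul_mul_smul]; congr 1; ring
  have a2 : -(s' • x) = G.mul (-((s' - s) • x)) (-(s • x)) := by
    rw [← neg_smul, ← neg_smul, ← neg_smul, G.smul_mul_smul]; congr 1; ring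
  change G.mul (-(s' • x)) (s' • y) = G.mul _ (G.mul c _)
  rw [a1, a2, hc]
  simp only [G.mul_assoc]

/-- Differential of the exponential map: the linear differential equation. -/
theorem hasDerivAt_dexp (x v : V) (s : ℝ) :
    HasDerivAt (fun s : ℝ => fderiv ℝ G.mulProd (-(s • x), s • x) (0, s • v))
      (v - G.bracket x (fderiv ℝ G.mulProd (-(s • x), s • x) (0, s • v))) s := by
  -- `c(s, ε) = exp(-s x) exp(s (x + ε v))` is the identity at `ε = 0`, and `J` is its
  -- `ε`-derivative there. The equation for `J` comes from exchanging the two derivatives: `∂_s c`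
  -- is known from `hasDerivAt_conj`, and its `ε`-derivative at the identity involves only the
  -- Hessian of the product, whose antisymmetrization is the bracket.
  set c : ℝ × ℝ → V := fun p => G.mul (-(p.1 • x)) (p.1 • (x + p.2 • v)) with hcdef
  have hc : ContDiff ℝ ∞ c := by
    refine G.contDiff_mul_comp ?_ ?_ <;> fun_prop
  have hcd : ∀ p, HasFDerivAt c (fderiv ℝ c p) p := fun p =>
    (hc.differentiable (by simp) p).hasFDerivAt
  have hc2 : ContDiff ℝ ∞ (fderiv ℝ c) := hc.fderiv_right (by simp)
  have hc2d : ∀ p, HasFDerivAt (fderiv ℝ c) (fderiv ℝ (fderiv ℝ c) p) p := fun p =>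
    (hc2.differentiable (by simp) p).hasFDerivAt
  have hc0 : ∀ s, c (s, 0) = 0 := fun s => by simp [hcdef, G.neg_mul]
  have hJ : ∀ s, fderiv ℝ c (s, 0) (0, 1) = fderiv ℝ G.mulProd (-(s • x), s • x) (0, s • v) := by
    intro s
    have h1 := (hcd (s, 0)).hasDerivAt_comp_prodMk
      (hasDerivAt_const (0 : ℝ) s) (hasDerivAt_id (0 : ℝ)) rfl
    have h2 := (G.hasFDerivAt_mulProd (-(s • x), s • x)).hasDerivAt_comp_prodMk
      (hasDerivAt_const (0 : ℝ) (-(s • x)))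
      (((hasDerivAt_smul_zero v).const_add x).const_smul s) (by simp)
    exact h1.unique h2
  have hs1 : ∀ ε, fderiv ℝ c (s, ε) (1, 0) =
      fderiv ℝ G.mulProd (c (s, ε), 0) (0, x + ε • v) - fderiv ℝ G.mulProd (0, c (s, ε)) (x, 0) := by
    intro ε
    have h1 := (hcd (s, ε)).hasDerivAt_comp_prodMk (hasDerivAt_id s) (hasDerivAt_const s ε) rfl
    exact h1.unique (G.hasDerivAt_conj x (x + ε • v) s)
  set J := fderiv ℝ c (s, 0) (0, 1) with hJs
  have hceps : HasDerivAt (fun ε => c (s, ε)) J 0 := by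
    exact (hcd (s, 0)).hasDerivAt_comp_prodMk (hasDerivAt_const (0 : ℝ) s)
      (hasDerivAt_id (0 : ℝ)) rfl
  have hH := G.hasFDerivAt_fderiv_mulProd
  have hmix : fderiv ℝ (fderiv ℝ c) (s, 0) (1, 0) (0, 1) = v - G.bracket x J := by
    have hsymm : fderiv ℝ (fderiv ℝ c) (s, 0) (1, 0) (0, 1) =
        fderiv ℝ (fderiv ℝ c) (s, 0) (0, 1) (1, 0) :=
      hc.contDiffAt.isSymmSndFDerivAt
        (by simpa using (ENat.LEInfty.out : (2 : ℕ∞ω) ≤ ∞)) _ _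
    rw [hsymm]
    have h1 := ((hc2d (s, 0)).hasDerivAt_comp_prodMk (hasDerivAt_const (0 : ℝ) s)
      (hasDerivAt_id (0 : ℝ)) rfl).clm_apply (hasDerivAt_const (0 : ℝ) ((1 : ℝ), (0 : ℝ)))
    have h2 := (hH.hasDerivAt_comp_prodMk hceps (hasDerivAt_const (0 : ℝ) (0 : V))
      (by rw [hc0]; rfl)).clm_apply ((hasDerivAt_const (0 : ℝ) (0 : V)).prodMk
        ((hasDerivAt_smul_zero v).const_add x))
    have h3 := (hH.hasDerivAt_comp_prodMk (hasDerivAt_const (0 : ℝ) (0 : V)) hceps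
      (by rw [hc0]; rfl)).clm_apply (hasDerivAt_const (0 : ℝ) ((x, 0) : V × V))
    have h5 : HasDerivAt (fun ε => fderiv ℝ c (s, ε) (1, 0)) _ 0 := h1
    have h6 := (h2.sub h3).congr_of_eventuallyEq (f₁ := fun ε => fderiv ℝ c (s, ε) (1, 0))
      (Eventually.of_forall fun ε => hs1 ε)
    have h7 := h5.unique h6
    simp only [map_zero, add_zero, id, zero_smul, hc0] at h7
    rw [h7, G.fderiv_mulProd_zero_left, bracket, G.mulHess_symm (0, J)]
    abel
  have hfin : HasDerivAt (fun s => fderiv ℝ c (s, 0) (0, 1)) (v - G.bracket x J) s := by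
    rw [← hmix]
    have h1 := ((hc2d (s, 0)).hasDerivAt_comp_prodMk (hasDerivAt_id s)
      (hasDerivAt_const s (0 : ℝ)) rfl).clm_apply (hasDerivAt_const s ((0 : ℝ), (1 : ℝ)))
    simpa using h1
  simp only [hJ] at hfin
  rwa [hJs, hJ] at hfin

theorem mulProd_mul_neg (x q : V) : G.mul x (G.mul (-x) q) = q := by
  rw [← G.mul_assoc, G.mul_neg, G.zero_mul]

theorem mulProd_neg_mul (x q : V) : G.mul (-x) (G.mul x q) = q := by
  rw [← G.mul_assoc, G.neg_mul, G.zero_mul]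

theorem fderiv_mulProd_comp (x x' q v : V) (h : ∀ q, G.mul x (G.mul x' q) = q) :
    fderiv ℝ G.mulProd (x, G.mul x' q) (0, fderiv ℝ G.mulProd (x', q) (0, v)) = v := by
  have h1 := (G.hasFDerivAt_mulProd (x', q)).comp q (hasFDerivAt_prodMk_right x' q)
  have h2 := (G.hasFDerivAt_mulProd (x, G.mul x' q)).comp q
    ((hasFDerivAt_const x q).prodMk h1)
  have h3 : HasFDerivAt (G.mulProd ∘ fun q => (x, G.mul x' q)) (ContinuousLinearMap.id ℝ V) q := by
    have : (G.mulProd ∘ fun q => (x, G.mul x' q)) = id := funext h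
    rw [this]
    exact hasFDerivAt_id q
  exact congrArg (fun L : V →L[ℝ] V => L v) (h2.unique h3)

/-- A Lie algebra endomorphism is a group endomorphism in exponential coordinates. -/
theorem map_mul_of_map_bracket (L : V →L[ℝ] V)
    (hL : ∀ x y, L (G.bracket x y) = G.bracket (L x) (L y)) (x y : V) :
    L (G.mul x y) = G.mul (L x) (L y) := by
  -- Along `s x`, both sides solve `p' = L v - [L x, p]` with `p(0) = 0`.
  have hω : ∀ x v, L (fderiv ℝ G.mulProd (-x, x) (0, v)) =
      fderiv ℝ G.mulProd (-(L x), L x) (0, L v) := by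
    intro x v
    have hX : ContDiff ℝ 1 (fun p => L v - G.bracket (L x) p) := by
      unfold bracket
      refine contDiff_const.sub (((G.mulHess (L x, 0)).contDiff.comp
        (contDiff_const.prodMk contDiff_id)).sub ?_)
      exact (G.mulHess.contDiff.comp (contDiff_id.prodMk contDiff_const)).clm_apply contDiff_const
    have h := eq_of_hasDerivAt_of_contDiff hX
      (f := fun s : ℝ => L (fderiv ℝ G.mulProd (-(s • x), s • x) (0, s • v)))
      (g := fun s : ℝ => fderiv ℝ G.mulProd (-(s • L x), s • L x) (0, s • L v))
      (fun s => by
        have := L.hasFDerivAt.comp_hasDerivAt s (G.hasDerivAt_dexp x v s)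
        rw [map_sub, hL] at this
        exact this)
      (fun s => G.hasDerivAt_dexp (L x) (L v) s) (by
        simp [G.fderiv_mulProd_zero_left])
    have := congrFun h 1
    simpa using this
  -- `L` intertwines left-invariant fields: the differential of left translation by `x` at the
  -- identity inverts that of left translation by `-x` at `x`, which `hω` handles.
  have hA : ∀ x v, L (fderiv ℝ G.mulProd (x, 0) (0, v)) =
      fderiv ℝ G.mulProd (L x, 0) (0, L v) := by
    intro x v
    have h1 : fderiv ℝ G.mulProd (-x, x) (0, fderiv ℝ G.mulProd (x, 0) (0, v)) = v := by
      have := G.fderiv_mulProd_comp (-x) x 0 v (G.mulProd_neg_mul x)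
      rwa [G.mul_zero] at this
    have h2 : ∀ w, fderiv ℝ G.mulProd (L x, 0) (0, fderiv ℝ G.mulProd (-(L x), L x) (0, w)) = w := by
      intro w
      have := G.fderiv_mulProd_comp (L x) (-(L x)) (L x) w (G.mulProd_mul_neg (L x))
      rwa [G.neg_mul] at this
    conv_rhs => rw [← h1, hω, h2]
  have hcurve : ∀ x y : V, ∀ s : ℝ, HasDerivAt (fun s : ℝ => G.mul x (s • y))
      (fderiv ℝ G.mulProd (G.mul x (s • y), 0) (0, y)) s := by
    intro x y s
    have h1 : HasDerivAt (fun h : ℝ => G.mulProd (G.mul x (s • y), h • y))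
        (fderiv ℝ G.mulProd (G.mul x (s • y), 0) (0, y)) 0 := by
      exact (G.hasFDerivAt_mulProd (G.mul x (s • y), 0)).hasDerivAt_comp_prodMk
        (hasDerivAt_const (0 : ℝ) _) (hasDerivAt_smul_zero y) (by simp)
    rw [← sub_self s] at h1
    refine (h1.comp_sub_const s s).congr_of_eventuallyEq (Eventually.of_forall fun s' => ?_)
    change G.mul x (s' • y) = G.mul (G.mul x (s • y)) ((s' - s) • y)
    rw [G.mul_assoc, G.smul_mul_smul]
    congr 2; ring
  have hX : ContDiff ℝ 1 (fun p => fderiv ℝ G.mulProd (p, 0) (0, L y)) :=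
    ((G.contDiff_fderiv_mulProd.of_le (by exact_mod_cast le_top)).comp
      (contDiff_id.prodMk contDiff_const)).clm_apply contDiff_const
  -- Both curves are integral curves of the left-invariant field of `L y` starting at `L x`.
  have h := eq_of_hasDerivAt_of_contDiff hX
    (f := fun s : ℝ => L (G.mul x (s • y))) (g := fun s : ℝ => G.mul (L x) (s • L y))
    (fun s => by
      have := L.hasFDerivAt.comp_hasDerivAt s (hcurve x y s)
      rw [hA] at this
      exact this)
    (fun s => hcurve (L x) (L y) s) (by simp [G.mul_zero])
  simpa using congrFun h 1

end HomogeneousGroup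

/-! ### Dilations: algebra, automorphism property, determinants. -/

namespace HomogeneousGroup

variable {V : Type*} [NormedAddCommGroup V] [NormedSpace ℝ V] (G : HomogeneousGroup V)

theorem grade_induction {p : V → Prop} (h : ∀ j, ∀ x ∈ G.grade j, p x) (h0 : p 0)
    (hadd : ∀ x y, p x → p y → p (x + y)) (x : V) : p x := by
  have hx : x ∈ ⨆ j, G.grade j := by rw [G.isInternal.submodule_iSup_eq_top]; trivial
  exact Submodule.iSup_induction G.grade (motive := p) hx h h0 hadd

/-- The projection onto the layer `Vʲ`. -/
def layerProj (j : ℕ) : V →ₗ[ℝ] V :=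
  (G.grade j).subtype ∘ₗ DirectSum.component ℝ ℕ (fun j => G.grade j) j ∘ₗ
    G.gradeEquiv.symm.toLinearMap

theorem layerProj_of_mem (j k : ℕ) {x : V} (hx : x ∈ G.grade k) :
    G.layerProj j x = if j = k then x else 0 := by
  have h : G.gradeEquiv.symm x = DirectSum.lof ℝ ℕ (fun j => G.grade j) k ⟨x, hx⟩ := by
    rw [LinearEquiv.symm_apply_eq]
    exact (DirectSum.coeLinearMap_lof G.grade k ⟨x, hx⟩).symm
  simp only [layerProj, LinearMap.comp_apply, LinearEquiv.coe_coe, h]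
  split_ifs with hjk
  · subst hjk
    simp
  · rw [DirectSum.component.of, dif_neg (Ne.symm hjk)]
    simp

/-- Being polynomial in `t`, the dilation is jointly smooth in `(t, x)` and extends to `t = 0`.
Limits `t → ∞` thus become continuity of `δ_ε` at `ε = 1/t = 0`. -/
theorem dilation_eq_sum (t : ℝ) (x : V) :
    G.dilation t x = ∑ j ∈ Finset.range (G.step + 1), t ^ j • G.layerProj j x := by
  induction x using G.grade_induction with
  | h k x hx =>
    rw [G.dilation_apply_of_mem t k x hx]
    simp only [G.layerProj_of_mem _ k hx, smul_ite, smul_zero, Finset.sum_ite_eq',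
      Finset.mem_range]
    split_ifs with hk
    · rfl
    · have h0 := G.grade_eq_bot k (Or.inr (by omega))
      rw [h0, Submodule.mem_bot] at hx
      simp [hx]
  | h0 => simp
  | hadd x y hx hy => simp [hx, hy, Finset.sum_add_distrib]

theorem dilation_zero : G.dilation 0 = 0 := by
  ext x
  induction x using G.grade_induction with
  | h k x hx =>
    rw [G.dilation_apply_of_mem 0 k x hx]
    rcases Nat.eq_zero_or_pos k with rfl | hk
    · rw [G.grade_eq_bot 0 (Or.inl rfl), Submodule.mem_bot] at hx
      simp [hx]
    · simp [hk.ne']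
  | h0 => simp
  | hadd x y hx hy => rw [map_add, map_add, hx, hy]

theorem dilation_one (x : V) : G.dilation 1 x = x := by
  induction x using G.grade_induction with
  | h k x hx => rw [G.dilation_apply_of_mem 1 k x hx, one_pow, one_smul]
  | h0 => simp
  | hadd x y hx hy => rw [map_add, hx, hy]

theorem dilation_dilation (s t : ℝ) (x : V) :
    G.dilation s (G.dilation t x) = G.dilation (s * t) x := by
  induction x using G.grade_induction with
  | h k x hx =>
    rw [G.dilation_apply_of_mem t k x hx, map_smul, G.dilation_apply_of_mem s k x hx,
      G.dilation_apply_of_mem _ k x hx, smul_smul, mul_pow, mul_comm]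
  | h0 => simp
  | hadd x y hx hy => rw [map_add, map_add, hx, hy, map_add]

theorem dilation_inv_dilation {t : ℝ} (ht : t ≠ 0) (x : V) :
    G.dilation t⁻¹ (G.dilation t x) = x := by
  rw [dilation_dilation, inv_mul_cancel₀ ht, dilation_one]

theorem dilation_dilation_inv {t : ℝ} (ht : t ≠ 0) (x : V) :
    G.dilation t (G.dilation t⁻¹ x) = x := by
  rw [dilation_dilation, mul_inv_cancel₀ ht, dilation_one]

theorem bracket_add_left (x x' y : V) :
    G.bracket (x + x') y = G.bracket x y + G.bracket x' y := by
  have h1 : ((x + x', 0) : V × V) = (x, 0) + (x', 0) := by simp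
  have h2 : ((0, x + x') : V × V) = (0, x) + (0, x') := by simp
  simp only [bracket, h1, h2, map_add, _root_.add_apply]
  abel

theorem bracket_zero_left (y : V) : G.bracket 0 y = 0 := by
  have h : ((0, 0) : V × V) = 0 := rfl
  simp [bracket, h]

theorem bracket_swap (x y : V) : G.bracket x y = -G.bracket y x := by
  simp [bracket]

variable [FiniteDimensional ℝ V]

/-- The dilation `δ_t` as a continuous linear map. -/
def dil (t : ℝ) : V →L[ℝ] V := (G.dilation t).toContinuousLinearMap

@[simp]
theorem dil_apply (t : ℝ) (x : V) : G.dil t x = G.dilation t x := rfl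

theorem contDiff_dilation {E : Type*} [NormedAddCommGroup E] [NormedSpace ℝ E] {a : E → ℝ}
    {f : E → V} {n : ℕ∞} (ha : ContDiff ℝ n a) (hf : ContDiff ℝ n f) :
    ContDiff ℝ n (fun x => G.dilation (a x) (f x)) := by
  simp only [dilation_eq_sum]
  exact ContDiff.sum fun j _ =>
    (ha.pow j).smul ((G.layerProj j).toContinuousLinearMap.contDiff.comp hf)

theorem continuous_dilation {E : Type*} [TopologicalSpace E] {a : E → ℝ}
    {f : E → V} (ha : Continuous a) (hf : Continuous f) :
    Continuous (fun x => G.dilation (a x) (f x)) := by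
  simp only [dilation_eq_sum]
  exact continuous_finsetSum _ fun j _ =>
    (ha.pow j).smul ((G.layerProj j).toContinuousLinearMap.continuous.comp hf)

theorem continuous_dil : Continuous G.dil :=
  continuous_clm_apply.2 fun _ => G.continuous_dilation continuous_id continuous_const

theorem exists_norm_dil_le : ∃ M : ℝ, ∀ t ∈ Icc (0 : ℝ) 1, ‖G.dil t‖ ≤ M :=
  (isCompact_Icc.bddAbove_image (G.continuous_dil.norm.continuousOn)).imp fun _ hM _ ht =>
    hM (mem_image_of_mem _ ht)

/-- It suffices that `δ_t` respects the bracket, which is checked on layers: the bracket of degrees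
`j` and `k` lies in degree `j + k`, and `t ^ j * t ^ k = t ^ (j + k)`. -/
theorem dilation_mul (t : ℝ) (x y : V) :
    G.dilation t (G.mul x y) = G.mul (G.dilation t x) (G.dilation t y) := by
  refine G.map_mul_of_map_bracket (G.dil t) (fun x y => ?_) x y
  simp only [dil_apply]
  have hsmul : ∀ (c : ℝ) (x y : V), G.bracket (c • x) y = c • G.bracket x y := by
    intro c x y
    have h1 : ((c • x, 0) : V × V) = c • (x, 0) := by simp
    have h2 : ((0, c • x) : V × V) = c • (0, x) := by simp
    simp only [bracket, h1, h2, map_smul, _root_.smul_apply, smul_sub]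
  have hsmul' : ∀ (c : ℝ) (x y : V), G.bracket x (c • y) = c • G.bracket x y := by
    intro c x y
    rw [bracket_swap, hsmul, ← smul_neg, ← bracket_swap]
  have hadd' : ∀ (x y y' : V), G.bracket x (y + y') = G.bracket x y + G.bracket x y' := by
    intro x y y'
    rw [bracket_swap, bracket_add_left, neg_add, ← bracket_swap, ← bracket_swap]
  induction x using G.grade_induction with
  | h j x hx =>
    induction y using G.grade_induction with
    | h k y hy =>
      have := G.lie_mem j k x y hx hy
      rw [lieBracket_eq_bracket] at this
      rw [G.dilation_apply_of_mem t j x hx, G.dilation_apply_of_mem t k y hy,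
        G.dilation_apply_of_mem t _ _ this, hsmul, hsmul', smul_smul, pow_add]
    | h0 => rw [bracket_swap, bracket_zero_left, map_zero, bracket_swap, bracket_zero_left]; simp
    | hadd y y' hy hy' => rw [map_add, hadd', hadd', map_add, hy, hy']
  | h0 => rw [map_zero, bracket_zero_left, bracket_zero_left, map_zero]
  | hadd x x' hx hx' => rw [map_add, bracket_add_left, bracket_add_left, map_add, hx, hx']

theorem det_dilation (t : ℝ) : LinearMap.det (G.dilation t) = t ^ G.homDim := by
  classical
  let v := fun j => Module.finBasis ℝ (G.grade j)
  let B := G.isInternal.collectedBasis v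
  have : Fintype (Σ j, Fin (Module.finrank ℝ (G.grade j))) := FiniteDimensional.fintypeBasisIndex B
  have hdiag : LinearMap.toMatrix B B (G.dilation t) =
      Matrix.diagonal fun a : Σ j, Fin (Module.finrank ℝ (G.grade j)) => t ^ a.1 := by
    ext a b
    have hb : B b ∈ G.grade b.1 := by
      simp only [B, DirectSum.IsInternal.collectedBasis_coe]
      exact SetLike.coe_mem _
    rw [LinearMap.toMatrix_apply, G.dilation_apply_of_mem t b.1 (B b) hb, map_smul,
      Module.Basis.repr_self, Matrix.diagonal_apply]
    by_cases h : a = b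
    · subst h; simp
    · simp [h]
  rw [← LinearMap.det_toMatrix B, hdiag, Matrix.det_diagonal, homDim, ← Finset.prod_pow_eq_pow_sum]
  have huniv : (Finset.univ : Finset (Σ j, Fin (Module.finrank ℝ (G.grade j)))) =
      (Finset.range (G.step + 1)).sigma fun j => Finset.univ := by
    ext ⟨j, k⟩
    simp only [Finset.mem_univ, Finset.mem_sigma, and_true, true_iff, Finset.mem_range]
    by_contra hj
    have h0 := G.grade_eq_bot j (Or.inr (by omega))
    have h1 : Module.finrank ℝ (G.grade j) = 0 := Submodule.finrank_eq_zero.2 h0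
    exact Fin.elim0 (h1 ▸ k)
  rw [huniv, Finset.prod_sigma]
  refine Finset.prod_congr rfl fun j _ => ?_
  simp [pow_mul]

theorem isCentral_dilation {z : V} (hz : G.IsCentral z) {t : ℝ} (ht : t ≠ 0) :
    G.IsCentral (G.dilation t z) := fun x => by
  have := congrArg (G.dilation t) (hz (G.dilation t⁻¹ x))
  rwa [dilation_mul, dilation_mul, dilation_dilation_inv _ ht] at this

/-- With `T` an inclusion of a factor, this is the Jacobian of a left or right translation. As `δ_t`
is an automorphism, the Jacobians at `p` and at `δ_t p` belong to conjugate maps and agree; letting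
`t → 0` moves the base point to the identity, where the differential is the identity. -/
theorem det_fderiv_mulProd_comp (T : V →L[ℝ] V × V)
    (hT : ∀ t x, T (G.dilation t x) = (G.dil t).prodMap (G.dil t) (T x))
    (hT0 : ∀ x, fderiv ℝ G.mulProd 0 (T x) = x) (p : V × V) :
    ((fderiv ℝ G.mulProd p).comp T).det = 1 := by
  have hinv : ∀ t : ℝ, 0 < t →
      ((fderiv ℝ G.mulProd ((G.dil t).prodMap (G.dil t) p)).comp T).det =
        ((fderiv ℝ G.mulProd p).comp T).det := by
    intro t ht
    have h1 := (G.hasFDerivAt_mulProd ((G.dil t).prodMap (G.dil t) p)).comp p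
      ((G.dil t).prodMap (G.dil t)).hasFDerivAt
    have h2 := (G.dil t).hasFDerivAt.comp p (G.hasFDerivAt_mulProd p)
    have h3 : G.mulProd ∘ ((G.dil t).prodMap (G.dil t)) = G.dil t ∘ G.mulProd :=
      funext fun q => (G.dilation_mul t q.1 q.2).symm
    rw [h3] at h1
    have h4 := h1.unique h2
    have h5 : ((fderiv ℝ G.mulProd ((G.dil t).prodMap (G.dil t) p)).comp T).comp (G.dil t) =
        (G.dil t).comp ((fderiv ℝ G.mulProd p).comp T) := by
      ext x
      have := congrArg (fun L : V × V →L[ℝ] V => L (T x)) h4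
      simpa [hT] using this
    have h6 : LinearMap.det ((((fderiv ℝ G.mulProd ((G.dil t).prodMap (G.dil t) p)).comp T :
        V →L[ℝ] V) : V →ₗ[ℝ] V) ∘ₗ G.dilation t) =
        LinearMap.det (G.dilation t ∘ₗ (((fderiv ℝ G.mulProd p).comp T : V →L[ℝ] V) : V →ₗ[ℝ] V)) :=
      congrArg (fun L : V →L[ℝ] V => LinearMap.det (L : V →ₗ[ℝ] V)) h5
    rw [LinearMap.det_comp, LinearMap.det_comp, mul_comm (LinearMap.det (G.dilation t))] at h6
    refine mul_right_cancel₀ ?_ h6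
    rw [G.det_dilation]
    positivity
  have hcont : Continuous fun t : ℝ =>
      ((fderiv ℝ G.mulProd ((G.dil t).prodMap (G.dil t) p)).comp T).det := by
    refine ContinuousLinearMap.continuous_det.comp ?_
    refine (G.contDiff_fderiv_mulProd.continuous.comp ?_).clm_comp continuous_const
    exact (G.continuous_dilation continuous_id continuous_const).prodMk
      (G.continuous_dilation continuous_id continuous_const)
  have h0 : ((fderiv ℝ G.mulProd ((G.dil 0).prodMap (G.dil 0) p)).comp T).det = 1 := by
    have e1 : (G.dil 0).prodMap (G.dil 0) p = 0 := by
      refine Prod.ext ?_ ?_ <;> simp [dilation_zero]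
    have e2 : (fderiv ℝ G.mulProd 0).comp T = ContinuousLinearMap.id ℝ V :=
      ContinuousLinearMap.ext hT0
    rw [e1, e2]
    simp [ContinuousLinearMap.det]
  have hlim := (hcont.tendsto 0).mono_left (nhdsWithin_le_nhds (s := Ioi (0 : ℝ)))
  rw [h0] at hlim
  refine tendsto_nhds_unique (tendsto_const_nhds (f := 𝓝[>] (0 : ℝ))) (hlim.congr' ?_)
  filter_upwards [self_mem_nhdsWithin] with t ht using hinv t ht

/-- `Q > 0` is what makes the factors `t ^ (-Q)` decay in all later limits. -/
theorem homDim_pos {z : V} (hz : z ≠ 0) : 0 < G.homDim := by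
  rw [Nat.pos_iff_ne_zero]
  intro h
  refine hz (G.grade_induction (p := fun x => x = 0) (fun j x hx => ?_) rfl
    (fun x y hx hy => by rw [hx, hy, add_zero]) z)
  by_cases hj : j = 0 ∨ G.step < j
  · rwa [G.grade_eq_bot j hj, Submodule.mem_bot] at hx
  · push Not at hj
    have := (Finset.sum_eq_zero_iff.1 h) j (Finset.mem_range.2 (by omega))
    rcases Nat.mul_eq_zero.1 this with h1 | h1
    · omega
    · rwa [Submodule.finrank_eq_zero.1 h1, Submodule.mem_bot] at hx

end HomogeneousGroup

/-! ### Haar measure under translations and dilations. -/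

theorem measurePreserving_of_det_fderiv_eq_one {V : Type*} [NormedAddCommGroup V]
    [NormedSpace ℝ V] [FiniteDimensional ℝ V] [MeasurableSpace V] [BorelSpace V] (μ : Measure V)
    [μ.IsAddHaarMeasure] {f : V → V} {f' : V → V →L[ℝ] V} (hf : ∀ x, HasFDerivAt f (f' x) x)
    (hdet : ∀ x, (f' x).det = 1) (hbij : Function.Bijective f) : MeasurePreserving f μ μ := by
  have hcont : Continuous f := continuous_iff_continuousAt.2 fun x => (hf x).continuousAt
  refine ⟨hcont.measurable, Measure.ext fun s hs => ?_⟩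
  rw [Measure.map_apply hcont.measurable hs]
  have h := lintegral_abs_det_fderiv_eq_addHaar_image μ (hcont.measurable hs)
    (fun x _ => (hf x).hasFDerivWithinAt) hbij.injective.injOn
  rw [image_preimage_eq s hbij.surjective] at h
  simpa [hdet] using h

namespace HomogeneousGroup

variable {V : Type*} [NormedAddCommGroup V] [NormedSpace ℝ V] (G : HomogeneousGroup V)
  [FiniteDimensional ℝ V] [MeasurableSpace V] [BorelSpace V] (μ : Measure V) [μ.IsAddHaarMeasure]

theorem measurePreserving_mul_left (x : V) : MeasurePreserving (fun y => G.mul x y) μ μ := by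
  refine measurePreserving_of_det_fderiv_eq_one μ (f' := fun y =>
    (fderiv ℝ G.mulProd (x, y)).comp (ContinuousLinearMap.inr ℝ V V)) (fun y => ?_) (fun y => ?_)
    (G.leftMul x).bijective
  · exact (G.hasFDerivAt_mulProd (x, y)).comp y (hasFDerivAt_prodMk_right x y)
  · exact G.det_fderiv_mulProd_comp _ (fun t w => by simp)
      (fun w => G.fderiv_mulProd_zero_left 0 w) _

theorem measurePreserving_mul_right (y : V) : MeasurePreserving (fun x => G.mul x y) μ μ := by
  refine measurePreserving_of_det_fderiv_eq_one μ (f' := fun x =>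
    (fderiv ℝ G.mulProd (x, y)).comp (ContinuousLinearMap.inl ℝ V V)) (fun x => ?_) (fun x => ?_)
    ⟨fun a b h => ?_, fun a => ⟨G.mul a (-y), ?_⟩⟩
  · exact HasFDerivAt.comp (g := G.mulProd) (f := fun p : V => (p, y)) x
      (G.hasFDerivAt_mulProd (x, y)) (hasFDerivAt_prodMk_left x y)
  · exact G.det_fderiv_mulProd_comp _ (fun t w => by simp)
      (fun w => G.fderiv_mulProd_zero_right 0 w) _
  · have := congrArg (fun w => G.mul w (-y)) h
    simpa [G.mul_assoc, G.mul_neg, G.mul_zero] using this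
  · simp [G.mul_assoc, G.neg_mul, G.mul_zero]

theorem integral_comp_mul_left (x : V) (f : V → ℂ) : ∫ y, f (G.mul x y) ∂μ = ∫ y, f y ∂μ :=
  (G.measurePreserving_mul_left μ x).integral_comp
    (G.leftMul x).measurableEmbedding f

theorem integral_comp_mul_right (y : V) (f : V → ℂ) : ∫ x, f (G.mul x y) ∂μ = ∫ x, f x ∂μ := by
  let e : V ≃ₜ V :=
    { toFun := fun x => G.mul x y
      invFun := fun x => G.mul x (-y)
      left_inv := fun x => by simp [G.mul_assoc, G.mul_neg, G.mul_zero]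
      right_inv := fun x => by simp [G.mul_assoc, G.neg_mul, G.mul_zero]
      continuous_toFun := G.continuous_mul_comp continuous_id continuous_const
      continuous_invFun := G.continuous_mul_comp continuous_id continuous_const }
  exact (G.measurePreserving_mul_right μ y).integral_comp e.measurableEmbedding f

theorem integral_comp_dilation {t : ℝ} (ht : 0 < t) (f : V → ℂ) :
    ∫ x, f (G.dilation t x) ∂μ = ((t : ℂ) ^ G.homDim)⁻¹ * ∫ x, f x ∂μ := by
  have hdet : LinearMap.det (G.dilation t) ≠ 0 := by
    rw [G.det_dilation]; positivity
  have hmap := Measure.map_linearMap_addHaar_eq_smul_addHaar μ hdet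
  have hemb : MeasurableEmbedding (G.dilation t) :=
    ((G.dilation t).isClosedEmbedding_of_injective
      (LinearMap.ker_eq_bot.2 (G.dilation_injective ht))).measurableEmbedding
  rw [← hemb.integral_map, hmap, integral_smul_measure, G.det_dilation,
    ENNReal.toReal_ofReal (abs_nonneg _), abs_of_pos (by positivity)]
  simp

end HomogeneousGroup

/-! ### Completeness of the spaces of test functions with fixed support, and Banach–Steinhaus. -/

section Complete

variable {E F : Type*} [NormedAddCommGroup E] [NormedSpace ℝ E] [NormedAddCommGroup F]
  [NormedSpace ℝ F]

/-- If the derivatives of every order converge uniformly, their limits form the Taylor series of the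
limit function. Completeness is then inherited from a product of Banach spaces. -/
theorem ContDiffMapSupportedIn.isClosed_range_pi_structureMapCLM (K : Compacts E) :
    IsClosed (range (ContinuousLinearMap.pi (ContDiffMapSupportedIn.structureMapCLM ℝ ⊤) :
      𝓓_{K}(E, F) →L[ℝ] Π i, BoundedContinuousFunction E (E [×i]→L[ℝ] F))) := by
  refine IsSeqClosed.isClosed fun u g hu hg => ?_
  choose f hf using hu
  have hfu : ∀ n i x, u n i x = iteratedFDeriv ℝ i (f n) x := by
    intro n i x
    rw [← hf n, ← ContDiffMapSupportedIn.structureMapCLM_top_apply (𝕜 := ℝ)]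
    rfl
  have hunif : ∀ i, TendstoUniformly (fun n x => iteratedFDeriv ℝ i (f n) x) (g i) atTop := by
    intro i
    have := BoundedContinuousFunction.tendsto_iff_tendstoUniformly.1 ((tendsto_pi_nhds.1 hg) i)
    have e : (fun n x => iteratedFDeriv ℝ i (f n) x) = fun n => ⇑(u n i) := by
      funext n x
      exact (hfu n i x).symm
    rw [e]
    exact this
  set φ : E → F := fun x => (g 0 x).curry0 with hφ
  have htay : HasFTaylorSeriesUpTo ∞ φ (fun x i => g i x) := by
    refine ⟨fun x => rfl, fun m _ x => ?_, fun m _ => (g m).continuous⟩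
    refine hasFDerivAt_of_tendstoUniformly (l := (atTop : Filter ℕ))
      (f := fun n x => iteratedFDeriv ℝ m (f n) x)
      (f' := fun n x => (iteratedFDeriv ℝ (m + 1) (f n) x).curryLeft)
      (g' := fun x => (g (m + 1) x).curryLeft) ?_ (fun n y => ?_)
      (fun y => (hunif m).tendsto_at y) x
    · have hc := (continuousMultilinearCurryLeftEquiv ℝ (fun _ : Fin (m + 1) => E) F).isometry
      exact hc.uniformContinuous.comp_tendstoUniformly (hunif (m + 1))
    · exact ((f n).contDiff.ftaylorSeries).fderiv m (by exact_mod_cast ENat.natCast_lt_top m) y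
  have hsm : ContDiff ℝ ∞ φ := htay.contDiff
  have hz : EqOn φ 0 (K : Set E)ᶜ := by
    intro x hx
    have h0 : g 0 x = 0 := by
      refine tendsto_nhds_unique ((hunif 0).tendsto_at x) ?_
      simp only [(f _).iteratedFDeriv_zero_on_compl hx]
      exact tendsto_const_nhds
    simp [hφ, h0]
  refine ⟨⟨φ, hsm, hz⟩, ?_⟩
  ext i x : 2
  change ContDiffMapSupportedIn.structureMapCLM ℝ ⊤ i _ x = g i x
  rw [ContDiffMapSupportedIn.structureMapCLM_top_apply]
  exact (htay.eq_iteratedFDeriv (by exact_mod_cast le_top) x).symm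

instance ContDiffMapSupportedIn.completeSpace [CompleteSpace F] (K : Compacts E) :
    CompleteSpace 𝓓_{K}(E, F) := by
  have h := ContDiffMapSupportedIn.isUniformEmbedding_pi_structureMapCLM (𝕜 := ℝ) (E := E) (F := F)
    (n := ⊤) (K := K)
  exact (completeSpace_iff_isComplete_range h.isUniformInducing).2
    (ContDiffMapSupportedIn.isClosed_range_pi_structureMapCLM K).isComplete

instance ContDiffMapSupportedIn.isCountablyGenerated_uniformity (K : Compacts E) :
    (uniformity 𝓓_{K}(E, F)).IsCountablyGenerated := by
  have h := ContDiffMapSupportedIn.isUniformEmbedding_pi_structureMapCLM (𝕜 := ℝ) (E := E) (F := F)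
    (n := ⊤) (K := K)
  rw [← h.isUniformInducing.comap_uniformity]
  infer_instance

instance ContDiffMapSupportedIn.baireSpace [CompleteSpace F] (K : Compacts E) :
    BaireSpace 𝓓_{K}(E, F) := by
  let := UniformSpace.pseudoMetricSpace 𝓓_{K}(E, F)
  infer_instance

end Complete

namespace Distr

variable {V : Type*} [NormedAddCommGroup V] [NormedSpace ℝ V]

/-- A pointwise limit of a sequence of distributions is a distribution. -/
theorem exists_of_tendsto {T : ℕ → Distr V} {k : TestFn V → ℂ}
    (h : ∀ ψ, Tendsto (fun n => T n ψ) atTop (𝓝 (k ψ))) : ∃ S : Distr V, ∀ ψ, S ψ = k ψ := by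
  refine ⟨TestFunction.mkCLM ℂ k (fun f g => ?_) (fun c f => ?_) (fun K hK => ?_), fun ψ => rfl⟩
  · refine tendsto_nhds_unique (h (f + g)) ?_
    simp only [map_add]
    exact (h f).add (h g)
  · refine tendsto_nhds_unique (h (c • f)) ?_
    simp only [map_smul]
    exact (h f).const_smul c
  · exact (continuousLinearMapOfTendsto (l := atTop)
      (fun n => (T n).comp (TestFunction.ofSupportedInCLM ℂ hK))
      (f := k ∘ TestFunction.ofSupportedIn hK) (tendsto_pi_nhds.2 fun ψ => h _)).continuous

/-! ### Pairing a cut-off distribution with smooth functions. -/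

/-- The product of a test function and a smooth function. -/
def mulSmooth (φ : TestFn V) (g : V → ℂ) : TestFn V :=
  open scoped Classical in
  if hg : ContDiff ℝ ∞ g then
    ⟨fun x => φ x * g x, φ.contDiff.mul hg, φ.hasCompactSupport.mul_right, fun _ _ => trivial⟩
  else 0

theorem mulSmooth_apply (φ : TestFn V) {g : V → ℂ} (hg : ContDiff ℝ ∞ g) (x : V) :
    mulSmooth φ g x = φ x * g x := by
  rw [mulSmooth, dif_pos hg]
  rfl

/-- The pairing of the compactly supported distribution `φ f` with a smooth function. -/
def pair (f : Distr V) (φ : TestFn V) (g : V → ℂ) : ℂ := f (mulSmooth φ g)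

theorem cutoff_eq_pair (f : Distr V) (φ ψ : TestFn V) : cutoff φ f ψ = pair f φ ψ := by
  rw [cutoff_apply, pair]
  congr 1
  ext x
  rw [testMul_apply, mulSmooth_apply φ ψ.contDiff]

variable (f f' : Distr V) (φ φ' : TestFn V) {g g' : V → ℂ}

theorem pair_add (hg : ContDiff ℝ ∞ g) (hg' : ContDiff ℝ ∞ g') :
    pair f φ (fun x => g x + g' x) = pair f φ g + pair f φ g' := by
  rw [pair, pair, pair, ← map_add]
  congr 1
  ext x
  rw [mulSmooth_apply φ (hg.add hg'), _root_.add_apply, mulSmooth_apply φ hg,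
    mulSmooth_apply φ hg', mul_add]

theorem pair_const_mul (c : ℂ) (hg : ContDiff ℝ ∞ g) :
    pair f φ (fun x => c * g x) = c * pair f φ g := by
  rw [pair, pair, ← smul_eq_mul, ← map_smul]
  congr 1
  ext x
  rw [mulSmooth_apply φ (contDiff_const.mul hg), _root_.smul_apply, mulSmooth_apply φ hg,
    smul_eq_mul, mul_left_comm]

theorem pair_sub (hg : ContDiff ℝ ∞ g) (hg' : ContDiff ℝ ∞ g') :
    pair f φ (fun x => g x - g' x) = pair f φ g - pair f φ g' := by
  rw [pair, pair, pair, ← map_sub]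
  congr 1
  ext x
  rw [mulSmooth_apply φ (hg.sub hg'), _root_.sub_apply, mulSmooth_apply φ hg,
    mulSmooth_apply φ hg', mul_sub]

theorem pair_test_sub (hg : ContDiff ℝ ∞ g) :
    pair f (φ - φ') g = pair f φ g - pair f φ' g := by
  rw [pair, pair, pair, ← map_sub]
  congr 1
  ext x
  rw [mulSmooth_apply _ hg, _root_.sub_apply, _root_.sub_apply, mulSmooth_apply φ hg,
    mulSmooth_apply φ' hg, sub_mul]

theorem pair_congr (hg : ContDiff ℝ ∞ g) (hg' : ContDiff ℝ ∞ g')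
    (h : ∀ x, φ x ≠ 0 → g x = g' x) : pair f φ g = pair f φ g' := by
  rw [pair, pair]
  congr 1
  ext x
  rw [mulSmooth_apply φ hg, mulSmooth_apply φ hg']
  by_cases hx : φ x = 0
  · simp [hx]
  · rw [h x hx]

/-- Smoothness of `g` can be dropped, since `mulSmooth` takes the default value `0` on functions
that are not smooth. -/
theorem pair_eq_zero (h : ∀ x, φ x ≠ 0 → g x = 0) : pair f φ g = 0 := by
  by_cases hg : ContDiff ℝ ∞ g
  · rw [pair_congr f φ hg contDiff_const h]
    have := pair_const_mul f φ 0 hg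
    simpa using this
  · rw [pair, mulSmooth, dif_neg hg, map_zero]

theorem pair_const (c : ℂ) : pair f φ (fun _ => c) = c * f φ := by
  rw [pair, ← smul_eq_mul, ← map_smul]
  congr 1
  ext x
  rw [mulSmooth_apply φ contDiff_const, _root_.smul_apply, smul_eq_mul, mul_comm]

end Distr

/-! ### Smooth families of test functions and parametric integrals. -/

section Families

variable {V P F : Type*} [NormedAddCommGroup V] [NormedSpace ℝ V] [NormedAddCommGroup P]
  [NormedSpace ℝ P] [NormedAddCommGroup F] [NormedSpace ℝ F]

theorem contDiff_iteratedFDeriv_param {Φ : P → V → F} (hΦ : ContDiff ℝ ∞ (Function.uncurry Φ))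
    (i : ℕ) : ContDiff ℝ ∞ (fun q : P × V => iteratedFDeriv ℝ i (Φ q.1) q.2) := by
  induction i with
  | zero =>
    simp only [iteratedFDeriv_zero_eq_comp, Function.comp_apply]
    exact (continuousMultilinearCurryFin0 ℝ V F).symm.contDiff.comp hΦ
  | succ i ih =>
    simp only [iteratedFDeriv_succ_eq_comp_left, Function.comp_apply]
    refine ContDiff.comp (g := (continuousMultilinearCurryLeftEquiv ℝ
      (fun _ : Fin (i + 1) => V) F).symm) (LinearIsometryEquiv.contDiff _) ?_
    refine ContDiff.fderiv (f := fun q : P × V => iteratedFDeriv ℝ i (Φ q.1)) (m := ∞) ?_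
      contDiff_snd (by simp)
    exact ih.comp (contDiff_fst.fst.prodMk contDiff_snd)

/-- A smooth family of test functions with supports in a fixed compact set is continuous. -/
theorem continuous_testFn_of_contDiff {Ψ : P → TestFn V}
    (hΨ : ContDiff ℝ ∞ (Function.uncurry fun p x => Ψ p x)) {K : Set V} (hK : IsCompact K)
    (hsupp : ∀ p, ∀ x ∉ K, Ψ p x = 0) : Continuous Ψ := by
  let K' : Compacts V := ⟨K, hK⟩
  have hK' : (K' : Set V) ⊆ ((⊤ : Opens V) : Set V) := fun _ _ => trivial
  let Ψ' : P → 𝓓_{K'}(V, ℂ) := fun p => ⟨Ψ p, (Ψ p).contDiff, fun x hx => hsupp p x hx⟩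
  have hc : Continuous Ψ' := by
    rw [ContDiffMapSupportedIn.continuous_iff_comp]
    intro i
    rw [continuous_iff_continuousAt]
    intro p₀
    rw [ContinuousAt, BoundedContinuousFunction.tendsto_iff_tendstoUniformly,
      Metric.tendstoUniformly_iff]
    intro ε hε
    have happ : ∀ p x, (ContDiffMapSupportedIn.structureMapCLM ℝ ⊤ i ∘ Ψ') p x =
        iteratedFDeriv ℝ i (Ψ p) x := by
      intro p x
      change ContDiffMapSupportedIn.structureMapCLM ℝ ⊤ i (Ψ' p) x = _
      rw [ContDiffMapSupportedIn.structureMapCLM_top_apply]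
      rfl
    simp only [happ]
    have hcont := (contDiff_iteratedFDeriv_param hΨ i).continuous
    have hev : ∀ᶠ p in 𝓝 p₀, ∀ x ∈ K,
        dist (iteratedFDeriv ℝ i (Ψ p₀) x) (iteratedFDeriv ℝ i (Ψ p) x) < ε := by
      refine hK.eventually_forall_of_forall_eventually fun x _ => ?_
      have hc2 : Continuous fun q : P × V =>
          dist (iteratedFDeriv ℝ i (Ψ p₀) q.2) (iteratedFDeriv ℝ i (Ψ q.1) q.2) :=
        (hcont.comp (continuous_const.prodMk continuous_snd)).dist hcont
      refine hc2.continuousAt.eventually_lt continuousAt_const ?_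
      simpa using hε
    filter_upwards [hev] with p hp x
    by_cases hx : x ∈ K
    · exact hp x hx
    · have h0 : ∀ p, iteratedFDeriv ℝ i (Ψ p) x = 0 := fun p =>
        (Ψ' p).iteratedFDeriv_zero_on_compl hx
      simpa [h0] using hε
  exact (TestFunction.continuous_ofSupportedIn hK').comp hc

theorem Distr.continuous_pair (f : Distr V) (φ : TestFn V) {Φ : P → V → ℂ}
    (hΦ : ContDiff ℝ ∞ (Function.uncurry Φ)) : Continuous fun p => Distr.pair f φ (Φ p) := by
  have hp : ∀ p, ContDiff ℝ ∞ (Φ p) := fun p => hΦ.comp (contDiff_prodMk_right p)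
  refine f.continuous.comp (continuous_testFn_of_contDiff (K := tsupport φ) ?_
    φ.hasCompactSupport fun p x hx => ?_)
  · simp only [Distr.mulSmooth_apply φ (hp _)]
    exact (φ.contDiff.comp contDiff_snd).mul hΦ
  · rw [Distr.mulSmooth_apply φ (hp _), image_eq_zero_of_notMem_tsupport hx, zero_mul]

end Families

section ParametricIntegral

variable {V P : Type*} [NormedAddCommGroup V] [NormedSpace ℝ V] [FiniteDimensional ℝ V]
  [NormedAddCommGroup P] [NormedSpace ℝ P] [MeasurableSpace V] [BorelSpace V]

/-- A parametric integral of a smooth function is smooth, if the supports are contained in a fixed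
compact set. -/
theorem contDiff_parametric_integral (μ : Measure V) [IsFiniteMeasureOnCompacts μ] {Φ : P → V → ℂ}
    (hΦ : ContDiff ℝ ∞ (Function.uncurry Φ)) {K : Set V} (hK : IsCompact K)
    (hsupp : ∀ p, ∀ x ∉ K, Φ p x = 0) : ContDiff ℝ ∞ fun p => ∫ x, Φ p x ∂μ := by
  -- The integral is the convolution of the constant `1` with the reflected function, evaluated at
  -- `0`; hence the sign in `Φ p (-x)`.
  have h := contDiffOn_convolution_right_with_param_comp (𝕜 := ℝ) (μ := μ) (n := ⊤)
    (ContinuousLinearMap.mul ℝ ℂ) (s := (univ : Set P)) (v := fun _ => (0 : V)) contDiffOn_const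
    (f := fun _ : V => (1 : ℂ)) (g := fun p x => Φ p (-x)) isOpen_univ hK.neg
    (fun p x _ hx => hsupp p (-x) (by simpa using hx))
    ((continuous_const (y := (1 : ℂ))).locallyIntegrable)
    ((hΦ.comp (contDiff_fst.prodMk contDiff_snd.neg)).contDiffOn)
  rw [contDiffOn_univ] at h
  simpa [convolution] using h

end ParametricIntegral

/-! ### Cut-off symbols: Fubini and smooth dependence on parameters. -/

namespace HomogeneousGroup

open Distr

variable {V : Type*} [NormedAddCommGroup V] [NormedSpace ℝ V] (G : HomogeneousGroup V)

theorem compDilation_apply [FiniteDimensional ℝ V] (ψ : TestFn V) {t : ℝ} (ht : 0 < t) (x : V) :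
    G.compDilation ψ ht x = ψ (G.dilation t x) := rfl

variable [FiniteDimensional ℝ V]

/-- In degree `-Q`, dilating the cutoff is the same as dilating the argument inversely. As `t → ∞`
the argument flattens to the constant `g 0`. -/
theorem pair_compDilation {f : Distr V} (hf : G.IsHomogeneous (-(G.homDim : ℤ)) f) (φ : TestFn V)
    {g : V → ℂ} (hg : ContDiff ℝ ∞ g) {t : ℝ} (ht : 0 < t) :
    pair f (G.compDilation φ ht) g = pair f φ (fun x => g (G.dilation t⁻¹ x)) := by
  have hg' : ContDiff ℝ ∞ fun x => g (G.dilation t⁻¹ x) :=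
    hg.comp (G.contDiff_dilation contDiff_const contDiff_id)
  have h := hf t ht (mulSmooth φ fun x => g (G.dilation t⁻¹ x))
  simp only [sub_self, zpow_zero, one_mul] at h
  rw [pair, pair, ← h]
  congr 1
  ext x
  rw [mulSmooth_apply _ hg, compDilation_apply, compDilation_apply, mulSmooth_apply _ hg',
    G.dilation_inv_dilation ht.ne']

theorem compDilation_eventually_eq_one {φ : TestFn V} (hφ : ∀ᶠ x in 𝓝 (0 : V), φ x = 1) {t : ℝ}
    (ht : 0 < t) : ∀ᶠ x in 𝓝 (0 : V), G.compDilation φ ht x = 1 := by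
  have hc : Tendsto (fun x => G.dilation t x) (𝓝 0) (𝓝 0) := by
    have := (G.dil t).continuous.tendsto 0
    rwa [map_zero] at this
  exact hc.eventually hφ

variable [MeasurableSpace V] [BorelSpace V] (μ : Measure V) [μ.IsAddHaarMeasure]

-- A cutoff vanishing near the origin removes the only singularity, so that the product with `f` is
-- a genuine test function.
omit [FiniteDimensional ℝ V] [BorelSpace V] [μ.IsAddHaarMeasure] in
theorem _root_.Distr.RepresentedBy.exists_testFn {f : Distr V} {F : V → ℂ}
    (hF : RepresentedBy μ f F) (χ : TestFn V)
    (hχ : ∀ᶠ x in 𝓝 (0 : V), χ x = 0) : ∃ w : TestFn V, (∀ x, w x = F x * χ x) ∧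
      ∀ g, ContDiff ℝ ∞ g → pair f χ g = ∫ x, w x * g x ∂μ := by
  have hsm : ContDiff ℝ ∞ fun x => F x * χ x := by
    rw [contDiff_iff_contDiffAt]
    intro x
    by_cases hx : x = 0
    · subst hx
      have : (fun x => F x * χ x) =ᶠ[𝓝 0] fun _ => 0 := by
        filter_upwards [hχ] with x hx
        rw [hx, MulZeroClass.mul_zero]
      exact contDiffAt_const.congr_of_eventuallyEq this
    · exact (hF.1.contDiffAt (isOpen_compl_singleton.mem_nhds hx)).mul χ.contDiff.contDiffAt
  refine ⟨⟨fun x => F x * χ x, hsm, χ.hasCompactSupport.mul_left, fun _ _ => trivial⟩,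
    fun x => rfl, fun g hg => ?_⟩
  rw [pair, hF.2]
  · refine integral_congr_ae (Eventually.of_forall fun x => ?_)
    change F x * mulSmooth χ g x = F x * χ x * g x
    rw [mulSmooth_apply _ hg, _root_.mul_assoc]
  · intro x hx hx0
    rw [mem_singleton_iff] at hx0
    subst hx0
    refine (notMem_tsupport_iff_eventuallyEq.2 ?_) hx
    filter_upwards [hχ] with x hx
    rw [mulSmooth_apply _ hg, hx, MulZeroClass.zero_mul, Pi.zero_apply]

omit [FiniteDimensional ℝ V] [BorelSpace V] [μ.IsAddHaarMeasure] in
theorem _root_.Distr.IsRegular.exists_testFn {f : Distr V} (hf : f.IsRegular μ) (χ : TestFn V)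
    (hχ : ∀ᶠ x in 𝓝 (0 : V), χ x = 0) : ∃ w : TestFn V, (∀ x, χ x = 0 → w x = 0) ∧
      ∀ g, ContDiff ℝ ∞ g → pair f χ g = ∫ x, w x * g x ∂μ := by
  obtain ⟨F, hF⟩ := hf
  obtain ⟨w, hw, hw'⟩ := hF.exists_testFn μ χ hχ
  exact ⟨w, fun x hx => by rw [hw, hx, MulZeroClass.mul_zero], hw'⟩

/-- The symbols commute with integrals of smooth functions over compact sets of parameters. -/
theorem pair_setIntegral {f : Distr V} (hf : f ∈ G.symbolSpace μ) {φ : TestFn V}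
    (hφ : ∀ᶠ x in 𝓝 (0 : V), φ x = 1) {P : Type*} [NormedAddCommGroup P] [NormedSpace ℝ P]
    [FiniteDimensional ℝ P] [MeasurableSpace P] [BorelSpace P] (ν : Measure P)
    [IsFiniteMeasureOnCompacts ν] {K : Set P} (hK : IsCompact K) {Φ : P → V → ℂ}
    (hΦ : ContDiff ℝ ∞ (Function.uncurry Φ)) {I : V → ℂ} (hI : ContDiff ℝ ∞ I)
    (hIeq : ∀ y, I y = ∫ p in K, Φ p y ∂ν) :
    pair f φ I = ∫ p in K, pair f φ (Φ p) ∂ν := by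
  have hp : ∀ p, ContDiff ℝ ∞ (Φ p) := fun p => hΦ.comp (contDiff_prodMk_right p)
  have : IsFiniteMeasure (ν.restrict K) := ⟨by simpa using hK.measure_lt_top⟩
  have hint : ∀ χ : TestFn V, IntegrableOn (fun p => pair f χ (Φ p)) K ν := fun χ =>
    (f.continuous_pair χ hΦ).continuousOn.integrableOn_compact hK
  -- The defect in Fubini's theorem does not change if all functions are composed with `δ_{1/t}`:
  -- the cutoff `φ - φ ∘ δ_t` gives a test function, for which the ordinary Fubini theorem holds,
  -- and the part with `φ ∘ δ_t` is rewritten by homogeneity.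
  have hstep : ∀ t : ℝ, (ht : 0 < t) →
      pair f φ I - ∫ p in K, pair f φ (Φ p) ∂ν =
        pair f φ (fun y => I (G.dilation t⁻¹ y)) -
          ∫ p in K, pair f φ (fun y => Φ p (G.dilation t⁻¹ y)) ∂ν := by
    intro t ht
    have hχ : ∀ᶠ x in 𝓝 (0 : V), (φ - G.compDilation φ ht) x = 0 := by
      filter_upwards [hφ, G.compDilation_eventually_eq_one hφ ht] with x h1 h2
      rw [_root_.sub_apply, h1, h2, sub_self]
    obtain ⟨w, -, hw⟩ := hf.1.exists_testFn μ _ hχ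
    have h1 : pair f (φ - G.compDilation φ ht) I =
        ∫ p in K, pair f (φ - G.compDilation φ ht) (Φ p) ∂ν := by
      rw [hw I hI]
      simp only [hw _ (hp _), hIeq, ← integral_const_mul]
      have hS : ∀ g : V → ℂ, ∫ x, w x * g x ∂μ = ∫ x in tsupport w, w x * g x ∂μ := fun g =>
        (setIntegral_eq_integral_of_forall_compl_eq_zero fun x hx => by
          rw [image_eq_zero_of_notMem_tsupport hx, MulZeroClass.zero_mul]).symm
      simp only [hS, integral_const_mul]
      simp only [← integral_const_mul]
      refine integral_integral_swap ?_
      rw [Measure.prod_restrict]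
      refine ContinuousOn.integrableOn_compact (w.hasCompactSupport.isCompact.prod hK)
        (Continuous.continuousOn ?_)
      exact (w.continuous.comp continuous_fst).mul
        (hΦ.continuous.comp (continuous_snd.prodMk continuous_fst))
    simp only [pair_test_sub _ _ _ hI, pair_test_sub _ _ _ (hp _)] at h1
    rw [integral_sub (hint _) (hint _)] at h1
    simp only [G.pair_compDilation hf.2 φ hI ht, G.pair_compDilation hf.2 φ (hp _) ht] at h1
    linear_combination h1
  have hc1 : Continuous fun ε : ℝ => pair f φ (fun y => I (G.dilation ε y)) :=
    f.continuous_pair φ (hI.comp (G.contDiff_dilation contDiff_fst contDiff_snd))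
  have hc2 : Continuous fun ε : ℝ => ∫ p in K, pair f φ (fun y => Φ p (G.dilation ε y)) ∂ν := by
    refine continuous_parametric_integral_of_continuous ?_ hK
    refine f.continuous_pair φ (P := ℝ × P) (Φ := fun q y => Φ q.2 (G.dilation q.1 y)) ?_
    exact hΦ.comp (contDiff_fst.snd.prodMk (G.contDiff_dilation contDiff_fst.fst contDiff_snd))
  have hlim := ((hc1.sub hc2).tendsto 0).comp
    (tendsto_inv_atTop_zero : Tendsto (fun t : ℝ => t⁻¹) atTop (𝓝 0))
  have hconst : Tendsto (fun _ : ℝ => pair f φ I - ∫ p in K, pair f φ (Φ p) ∂ν) atTop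
      (𝓝 (pair f φ (fun y => I (G.dilation 0 y)) -
        ∫ p in K, pair f φ (fun y => Φ p (G.dilation 0 y)) ∂ν)) := by
    refine hlim.congr' ?_
    filter_upwards [eventually_gt_atTop 0] with t ht using (hstep t ht).symm
  -- In the limit the functions are constant in `y`, and the defect is evidently zero.
  have h0 := tendsto_nhds_unique tendsto_const_nhds hconst
  simp only [dilation_zero, LinearMap.zero_apply, pair_const, hIeq 0, integral_mul_const,
    sub_self] at h0
  exact sub_eq_zero.1 h0

section Smooth

variable {f : Distr V} (hf : f ∈ G.symbolSpace μ) {φ : TestFn V}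
  (hφ : ∀ᶠ x in 𝓝 (0 : V), φ x = 1) {P : Type*} [NormedAddCommGroup P] [NormedSpace ℝ P]
  [FiniteDimensional ℝ P] {Φ : P → V → ℂ} (hΦ : ContDiff ℝ ∞ (Function.uncurry Φ))
include hf hφ hΦ

/-- The fundamental theorem of calculus writes `Φ (p + q) - Φ p` as an integral of derivatives, and
Fubini moves the pairing inside. Continuity of the candidate derivative `L` then gives
differentiability, without convergence of difference quotients in the space of test functions. -/
theorem exists_hasFDerivAt_pair (p : P) : ∃ L : P →L[ℝ] ℂ,
    HasFDerivAt (fun p => pair f φ (Φ p)) L p ∧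
      ∀ q, L q = pair f φ fun y => fderiv ℝ (Function.uncurry Φ) (p, y) (q, 0) := by
  have hD : ∀ q : P, ContDiff ℝ ∞ (Function.uncurry fun (p : P) (y : V) =>
      fderiv ℝ (Function.uncurry Φ) (p, y) (q, 0)) := fun q =>
    (hΦ.fderiv_right (m := ∞) (by simp)).clm_apply contDiff_const
  have hD' : ∀ q p, ContDiff ℝ ∞ fun y : V => fderiv ℝ (Function.uncurry Φ) (p, y) (q, 0) :=
    fun q p => (hD q).comp (contDiff_prodMk_right p)
  have hp : ∀ p, ContDiff ℝ ∞ (Φ p) := fun p => hΦ.comp (contDiff_prodMk_right p)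
  let L : P → P →L[ℝ] ℂ := fun p => LinearMap.toContinuousLinearMap
    { toFun := fun q => pair f φ fun y => fderiv ℝ (Function.uncurry Φ) (p, y) (q, 0)
      map_add' := fun q q' => by
        rw [← pair_add f φ (hD' q p) (hD' q' p)]
        congr 1
        funext y
        rw [← map_add]
        simp
      map_smul' := fun c q => by
        have := pair_const_mul f φ (c : ℂ) (hD' q p)
        rw [RingHom.id_apply, Complex.real_smul, ← this]
        congr 1
        funext y
        rw [← Complex.real_smul, ← map_smul]
        simp }
  have hL : ∀ p q, L p q = pair f φ fun y => fderiv ℝ (Function.uncurry Φ) (p, y) (q, 0) :=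
    fun _ _ => rfl
  have hLc : Continuous L := continuous_clm_apply.2 fun q => f.continuous_pair φ (hD q)
  have key : ∀ p q, pair f φ (Φ (p + q)) - pair f φ (Φ p) =
      ∫ σ in Icc (0 : ℝ) 1, L (p + σ • q) q := by
    intro p q
    rw [← pair_sub f φ (hp _) (hp _)]
    simp only [hL]
    refine G.pair_setIntegral μ hf hφ (volume : Measure ℝ) isCompact_Icc
      (Φ := fun σ y => fderiv ℝ (Function.uncurry Φ) (p + σ • q, y) (q, 0)) ?_
      ((hp _).sub (hp _)) fun y => ?_
    · exact (hD q).comp (((contDiff_const.add (contDiff_fst.smul contDiff_const))).prodMk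
        contDiff_snd)
    · have hder : ∀ σ : ℝ, HasDerivAt (fun σ : ℝ => Φ (p + σ • q) y)
          (fderiv ℝ (Function.uncurry Φ) (p + σ • q, y) (q, 0)) σ := by
        intro σ
        have h1 : HasDerivAt (fun σ : ℝ => p + σ • q) q σ := by
          simpa using ((hasDerivAt_id σ).smul_const q).const_add p
        exact ((hΦ.differentiable (by simp) (p + σ • q, y)).hasFDerivAt).hasDerivAt_comp_prodMk
          h1 (hasDerivAt_const σ y) rfl
      have hcont : Continuous fun σ : ℝ =>
          fderiv ℝ (Function.uncurry Φ) (p + σ • q, y) (q, 0) :=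
        (hD q).continuous.comp (Continuous.prodMk (by fun_prop) continuous_const)
      have := intervalIntegral.integral_eq_sub_of_hasDerivAt (a := 0) (b := 1)
        (fun σ _ => hder σ) (hcont.intervalIntegrable 0 1)
      rw [intervalIntegral.integral_of_le zero_le_one, ← integral_Icc_eq_integral_Ioc] at this
      rw [this]
      simp
  refine ⟨L p, ?_, hL p⟩
  rw [hasFDerivAt_iff_isLittleO_nhds_zero, Asymptotics.isLittleO_iff]
  intro ε hε
  obtain ⟨δ, hδ, hball⟩ := Metric.continuousAt_iff.1 (hLc.continuousAt (x := p)) ε hε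
  filter_upwards [Metric.ball_mem_nhds (0 : P) hδ] with q hq
  rw [key p q]
  have hconst : L p q = ∫ σ in Icc (0 : ℝ) 1, L p q := by simp
  have hc : Continuous fun σ : ℝ => L (p + σ • q) q :=
    (hLc.comp (by fun_prop : Continuous fun σ : ℝ => p + σ • q)).clm_apply continuous_const
  rw [hconst, ← integral_sub hc.continuousOn.integrableOn_Icc
    continuous_const.continuousOn.integrableOn_Icc]
  have hbd := norm_setIntegral_le_of_norm_le_const (μ := (volume : Measure ℝ))
    (s := Icc (0 : ℝ) 1) (f := fun σ => L (p + σ • q) q - L p q) (C := ε * ‖q‖) (by simp)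
    (fun σ hσ => by
      rw [← _root_.sub_apply]
      refine (ContinuousLinearMap.le_opNorm _ _).trans
        (mul_le_mul_of_nonneg_right ?_ (norm_nonneg q))
      rw [← dist_eq_norm]
      refine (hball ?_).le
      rw [dist_eq_norm, add_sub_cancel_left, norm_smul, Real.norm_of_nonneg hσ.1]
      rw [mem_ball_zero_iff] at hq
      exact (mul_le_of_le_one_left (norm_nonneg q) hσ.2).trans_lt hq)
  simpa using hbd

theorem contDiff_pair : ContDiff ℝ ∞ fun p => pair f φ (Φ p) := by
  rw [contDiff_infty]
  intro n
  induction n generalizing Φ with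
  | zero => exact contDiff_zero.2 (f.continuous_pair φ hΦ)
  | succ n ih =>
    have h := G.exists_hasFDerivAt_pair μ hf hφ hΦ
    choose L hL hLq using h
    rw [Nat.cast_succ, contDiff_succ_iff_fderiv_apply]
    refine ⟨fun p => (hL p).differentiableAt, fun hn => by simp at hn, fun q => ?_⟩
    have : (fun p => fderiv ℝ (fun p => pair f φ (Φ p)) p q) =
        fun p => pair f φ fun y => fderiv ℝ (Function.uncurry Φ) (p, y) (q, 0) :=
      funext fun p => by rw [(hL p).fderiv, hLq]
    rw [this]
    exact ih ((hΦ.fderiv_right (m := ∞) (by simp)).clm_apply contDiff_const)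

end Smooth

section Fubini

variable {f : Distr V} (hf : f ∈ G.symbolSpace μ) {φ : TestFn V}
  (hφ : ∀ᶠ x in 𝓝 (0 : V), φ x = 1)
include hf hφ

theorem pair_integral {Φ : V → V → ℂ} (hΦ : ContDiff ℝ ∞ (Function.uncurry Φ)) {K : Set V}
    (hK : IsCompact K) (hsupp : ∀ p ∉ K, ∀ y, Φ p y = 0) :
    pair f φ (fun y => ∫ p, Φ p y ∂μ) = ∫ p, pair f φ (Φ p) ∂μ := by
  rw [← setIntegral_eq_integral_of_forall_compl_eq_zero (s := K)
    (fun p hp => pair_eq_zero f φ fun y _ => hsupp p hp y)]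
  refine G.pair_setIntegral μ hf hφ μ hK hΦ ?_ fun y =>
    (setIntegral_eq_integral_of_forall_compl_eq_zero fun p hp => hsupp p hp y).symm
  exact contDiff_parametric_integral μ (Φ := fun y p => Φ p y)
    (hΦ.comp (contDiff_snd.prodMk contDiff_fst)) hK fun y p hp => hsupp p hp y

/-- Convolution of a test function with a symbol. -/
theorem integral_mul_pair (w ψ : TestFn V) :
    ∫ x, w x * pair f φ (fun y => ψ (G.mul x y)) ∂μ =
      ∫ z, ψ z * pair f φ (fun y => w (G.mul z (-y))) ∂μ := by
  have h1 : ∀ x, ContDiff ℝ ∞ fun y => ψ (G.mul x y) := fun x =>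
    ψ.contDiff.comp (G.contDiff_mul_comp contDiff_const contDiff_id)
  have h2 : ∀ z, ContDiff ℝ ∞ fun y => w (G.mul z (-y)) := fun z =>
    w.contDiff.comp (G.contDiff_mul_comp contDiff_const contDiff_id.neg)
  simp only [← pair_const_mul f φ _ (h1 _), ← pair_const_mul f φ _ (h2 _)]
  rw [← G.pair_integral μ hf hφ (Φ := fun x y => w x * ψ (G.mul x y)) ?_
      w.hasCompactSupport.isCompact (fun p hp y => by
        rw [image_eq_zero_of_notMem_tsupport hp, MulZeroClass.zero_mul]),
    ← G.pair_integral μ hf hφ (Φ := fun z y => ψ z * w (G.mul z (-y))) ?_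
      ψ.hasCompactSupport.isCompact (fun p hp y => by
        rw [image_eq_zero_of_notMem_tsupport hp, MulZeroClass.zero_mul])]
  · congr 1
    funext y
    -- The substitution `z = x y` for fixed `y` uses right invariance of `μ`; the mirror statement
    -- `pair_integral_mul` uses left invariance.
    rw [← G.integral_comp_mul_right μ y fun z => ψ z * w (G.mul z (-y))]
    refine integral_congr_ae (Eventually.of_forall fun x => ?_)
    simp [G.mul_assoc, G.mul_neg, G.mul_zero, mul_comm]
  · exact (ψ.contDiff.comp contDiff_fst).mul
      (w.contDiff.comp (G.contDiff_mul_comp contDiff_fst contDiff_snd.neg))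
  · exact (w.contDiff.comp contDiff_fst).mul
      (ψ.contDiff.comp (G.contDiff_mul_comp contDiff_fst contDiff_snd))

/-- Convolution of a symbol with a test function. -/
theorem pair_integral_mul (w ψ : TestFn V) :
    pair f φ (fun x => ∫ y, w y * ψ (G.mul x y) ∂μ) =
      ∫ z, ψ z * pair f φ (fun x => w (G.mul (-x) z)) ∂μ := by
  have h2 : ∀ z, ContDiff ℝ ∞ fun x => w (G.mul (-x) z) := fun z =>
    w.contDiff.comp (G.contDiff_mul_comp contDiff_id.neg contDiff_const)
  simp only [← pair_const_mul f φ _ (h2 _)]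
  rw [← G.pair_integral μ hf hφ (Φ := fun z x => ψ z * w (G.mul (-x) z)) ?_
      ψ.hasCompactSupport.isCompact (fun p hp y => by
        rw [image_eq_zero_of_notMem_tsupport hp, MulZeroClass.zero_mul])]
  · congr 1
    funext x
    rw [← G.integral_comp_mul_left μ x fun z => ψ z * w (G.mul (-x) z)]
    refine integral_congr_ae (Eventually.of_forall fun y => ?_)
    simp [← G.mul_assoc, G.neg_mul, G.zero_mul, mul_comm]
  · exact (ψ.contDiff.comp contDiff_fst).mul
      (w.contDiff.comp (G.contDiff_mul_comp contDiff_snd.neg contDiff_fst))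

end Fubini

end HomogeneousGroup

namespace Distr

variable {V : Type*} [NormedAddCommGroup V] [NormedSpace ℝ V] [MeasurableSpace V] [BorelSpace V]
  (μ : Measure V) [IsFiniteMeasureOnCompacts μ]

/-- The distribution given by a function. -/
def ofFun (c : V → ℂ) : Distr V :=
  TestFunction.integralAgainstBilinCLM (ContinuousLinearMap.mul ℂ ℂ) μ c

variable [FiniteDimensional ℝ V]

theorem ofFun_apply {c : V → ℂ} (hc : Continuous c) (ψ : TestFn V) :
    ofFun μ c ψ = ∫ x, c x * ψ x ∂μ := by
  have := hc.locallyIntegrable (μ := μ)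
  rw [ofFun, TestFunction.integralAgainstBilinCLM_eq_integral (this.locallyIntegrableOn _)]
  simp [mul_comm]

omit [FiniteDimensional ℝ V] in
theorem integrable_mul_test {c : V → ℂ} (hc : Continuous c) (ψ : TestFn V) :
    Integrable (fun x => c x * ψ x) μ :=
  (hc.mul ψ.continuous).integrable_of_hasCompactSupport ψ.hasCompactSupport.mul_left

end Distr

/-! ### Convolution of cut-off symbols and its dependence on the cutoff. -/

namespace HomogeneousGroup

open Distr

variable {V : Type*} [NormedAddCommGroup V] [NormedSpace ℝ V] (G : HomogeneousGroup V)

/-- The convolution of the compactly supported distributions `φ f` and `φ' g`. -/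
def convPair (f : Distr V) (φ : TestFn V) (g : Distr V) (φ' : TestFn V) (ψ : V → ℂ) : ℂ :=
  pair f φ fun x => pair g φ' fun y => ψ (G.mul x y)

theorem convPair_eq_zero {f g : Distr V} {φ φ' : TestFn V} {ψ : V → ℂ}
    (h : ∀ x y, φ x ≠ 0 → φ' y ≠ 0 → ψ (G.mul x y) = 0) : G.convPair f φ g φ' ψ = 0 :=
  pair_eq_zero f φ fun x hx => pair_eq_zero g φ' fun y hy => h x y hx hy

variable [FiniteDimensional ℝ V] [MeasurableSpace V] [BorelSpace V] (μ : Measure V)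
  [μ.IsAddHaarMeasure]

section

variable {g : Distr V} (hg : g ∈ G.symbolSpace μ) {φ : TestFn V}
  (hφ : ∀ᶠ x in 𝓝 (0 : V), φ x = 1)
include hg hφ

theorem contDiff_pair_mul_left {ψ : V → ℂ} (hψ : ContDiff ℝ ∞ ψ) :
    ContDiff ℝ ∞ fun x => pair g φ fun y => ψ (G.mul x y) :=
  G.contDiff_pair μ hg hφ (hψ.comp (G.contDiff_mul_comp contDiff_fst contDiff_snd))

theorem exists_testFn_pair_mul_left (ψ : TestFn V) :
    ∃ F : TestFn V, ∀ x, F x = pair g φ fun y => ψ (G.mul x y) := by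
  have hK : IsCompact ((fun p : V × V => G.mul p.1 (-p.2)) '' (tsupport ψ ×ˢ tsupport φ)) :=
    (ψ.hasCompactSupport.isCompact.prod φ.hasCompactSupport).image
      (G.continuous_mul_comp continuous_fst continuous_snd.neg)
  refine ⟨⟨_, G.contDiff_pair_mul_left μ hg hφ ψ.contDiff, HasCompactSupport.intro hK fun x hx => ?_,
    fun _ _ => trivial⟩, fun x => rfl⟩
  refine pair_eq_zero g φ fun y hy => ?_
  by_contra hne
  refine hx ⟨(G.mul x y, y), ⟨subset_tsupport _ hne, subset_tsupport _ hy⟩, ?_⟩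
  simp [G.mul_assoc, G.mul_neg, G.mul_zero]

theorem exists_testFn_pair_mul_neg (w : TestFn V) :
    ∃ F : TestFn V, ∀ z, F z = pair g φ fun y => w (G.mul z (-y)) := by
  have hK : IsCompact ((fun p : V × V => G.mul p.1 p.2) '' (tsupport w ×ˢ tsupport φ)) :=
    (w.hasCompactSupport.isCompact.prod φ.hasCompactSupport).image
      (G.continuous_mul_comp continuous_fst continuous_snd)
  have hsm : ContDiff ℝ ∞ fun z => pair g φ fun y => w (G.mul z (-y)) :=
    G.contDiff_pair μ hg hφ
      (w.contDiff.comp (G.contDiff_mul_comp contDiff_fst contDiff_snd.neg))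
  refine ⟨⟨_, hsm, HasCompactSupport.intro hK fun x hx => ?_, fun _ _ => trivial⟩, fun x => rfl⟩
  refine pair_eq_zero g φ fun y hy => ?_
  by_contra hne
  refine hx ⟨(G.mul x (-y), y), ⟨subset_tsupport _ hne, subset_tsupport _ hy⟩, ?_⟩
  simp [G.mul_assoc, G.neg_mul, G.mul_zero]

theorem exists_testFn_pair_neg_mul (w : TestFn V) :
    ∃ F : TestFn V, ∀ z, F z = pair g φ fun x => w (G.mul (-x) z) := by
  have hK : IsCompact ((fun p : V × V => G.mul p.1 p.2) '' (tsupport φ ×ˢ tsupport w)) :=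
    (φ.hasCompactSupport.isCompact.prod w.hasCompactSupport).image
      (G.continuous_mul_comp continuous_fst continuous_snd)
  have hsm : ContDiff ℝ ∞ fun z => pair g φ fun x => w (G.mul (-x) z) :=
    G.contDiff_pair μ hg hφ
      (w.contDiff.comp (G.contDiff_mul_comp contDiff_snd.neg contDiff_fst))
  refine ⟨⟨_, hsm, HasCompactSupport.intro hK fun x hx => ?_, fun _ _ => trivial⟩, fun x => rfl⟩
  refine pair_eq_zero g φ fun y hy => ?_
  by_contra hne
  refine hx ⟨(y, G.mul (-y) x), ⟨subset_tsupport _ hy, subset_tsupport _ hne⟩, ?_⟩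
  simp [← G.mul_assoc, G.mul_neg, G.zero_mul]

end

variable {f g : Distr V} (hf : f ∈ G.symbolSpace μ) (hg : g ∈ G.symbolSpace μ)

-- The difference is the convolution of the test function `w` with `φ g`, which is the smooth
-- function `z ↦ ⟨φ g, w(z y⁻¹)⟩`.
include hg in
theorem convPair_sub_left {φ₁ φ₂ φ : TestFn V} (hφ : ∀ᶠ x in 𝓝 (0 : V), φ x = 1) {w : TestFn V}
    (hw : ∀ g, ContDiff ℝ ∞ g → pair f (φ₁ - φ₂) g = ∫ x, w x * g x ∂μ) (ψ : TestFn V) :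
    G.convPair f φ₁ g φ ψ - G.convPair f φ₂ g φ ψ =
      ∫ z, ψ z * pair g φ (fun y => w (G.mul z (-y))) ∂μ := by
  have h := G.contDiff_pair_mul_left μ hg hφ ψ.contDiff
  rw [convPair, convPair, ← pair_test_sub f φ₁ φ₂ h, hw _ h, G.integral_mul_pair μ hg hφ]

-- Here the difference is `φ f` convolved with a test function; the variable to be inverted now
-- stands on the left, as `x⁻¹ z`. This difference of sides is all that the trace property has to
-- compare.
include hf hg in
theorem convPair_sub_right {φ₁ φ₂ φ : TestFn V} (hφ : ∀ᶠ x in 𝓝 (0 : V), φ x = 1)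
    (hφ₁ : ∀ᶠ x in 𝓝 (0 : V), φ₁ x = 1) (hφ₂ : ∀ᶠ x in 𝓝 (0 : V), φ₂ x = 1) {w : TestFn V}
    (hw : ∀ h, ContDiff ℝ ∞ h → pair g (φ₁ - φ₂) h = ∫ x, w x * h x ∂μ) (ψ : TestFn V) :
    G.convPair f φ g φ₁ ψ - G.convPair f φ g φ₂ ψ =
      ∫ z, ψ z * pair f φ (fun x => w (G.mul (-x) z)) ∂μ := by
  have h₁ := G.contDiff_pair_mul_left μ hg hφ₁ ψ.contDiff
  have h₂ := G.contDiff_pair_mul_left μ hg hφ₂ ψ.contDiff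
  have hψ : ∀ x, ContDiff ℝ ∞ fun y => ψ (G.mul x y) := fun x =>
    ψ.contDiff.comp (G.contDiff_mul_comp contDiff_const contDiff_id)
  rw [convPair, convPair, ← pair_sub f φ h₁ h₂, ← G.pair_integral_mul μ hf hφ]
  congr 1
  funext x
  rw [← pair_test_sub g φ₁ φ₂ (hψ x), hw _ (hψ x)]

-- Dilations are automorphisms, so dilating the test function only dilates the two cutoffs. Together
-- with cutoff independence, this makes the convolution homogeneous modulo test functions.
include hf in
theorem convPair_compDilation {φ φ' : TestFn V} (hg : g ∈ G.symbolSpace μ)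
    (hφ' : ∀ᶠ x in 𝓝 (0 : V), φ' x = 1) {t : ℝ} (ht : 0 < t) (ψ : TestFn V) :
    G.convPair f φ g φ' (G.compDilation ψ ht) =
      G.convPair f (G.compDilation φ (inv_pos.2 ht)) g (G.compDilation φ' (inv_pos.2 ht)) ψ := by
  have hψ : ∀ x, ContDiff ℝ ∞ fun y => ψ (G.mul x y) := fun x =>
    ψ.contDiff.comp (G.contDiff_mul_comp contDiff_const contDiff_id)
  have h := G.contDiff_pair_mul_left μ hg
    (G.compDilation_eventually_eq_one hφ' (inv_pos.2 ht)) ψ.contDiff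
  rw [convPair, convPair, G.pair_compDilation hf.2 φ h]
  congr 1
  funext x
  rw [G.pair_compDilation hg.2 φ' (hψ _)]
  simp only [inv_inv, ← G.dilation_mul, compDilation_apply]

omit [FiniteDimensional ℝ V] [MeasurableSpace V] [BorelSpace V] in
theorem eventually_sub_eq_zero {φ₁ φ₂ : TestFn V} (hφ₁ : ∀ᶠ x in 𝓝 (0 : V), φ₁ x = 1)
    (hφ₂ : ∀ᶠ x in 𝓝 (0 : V), φ₂ x = 1) : ∀ᶠ x in 𝓝 (0 : V), (φ₁ - φ₂) x = 0 := by
  filter_upwards [hφ₁, hφ₂] with x h1 h2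
  rw [_root_.sub_apply, h1, h2, sub_self]

include hf hg in
/-- Convolutions for different cutoff functions differ by a test function. -/
theorem exists_testFn_convPair_sub {φ₁ φ₂ : TestFn V} (hφ₁ : ∀ᶠ x in 𝓝 (0 : V), φ₁ x = 1)
    (hφ₂ : ∀ᶠ x in 𝓝 (0 : V), φ₂ x = 1) : ∃ s : TestFn V, ∀ ψ : TestFn V,
      G.convPair f φ₁ g φ₁ ψ - G.convPair f φ₂ g φ₂ ψ = ∫ x, s x * ψ x ∂μ := by
  obtain ⟨w, -, hw⟩ := hf.1.exists_testFn μ _ (eventually_sub_eq_zero hφ₁ hφ₂)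
  obtain ⟨w', -, hw'⟩ := hg.1.exists_testFn μ _ (eventually_sub_eq_zero hφ₁ hφ₂)
  obtain ⟨s₁, hs₁⟩ := G.exists_testFn_pair_mul_neg μ hg hφ₁ w
  obtain ⟨s₂, hs₂⟩ := G.exists_testFn_pair_neg_mul μ hf hφ₂ w'
  refine ⟨s₁ + s₂, fun ψ => ?_⟩
  have h1 := G.convPair_sub_left μ hg hφ₁ hw ψ
  have h2 := G.convPair_sub_right μ hf hg hφ₂ hφ₁ hφ₂ hw' ψ
  simp only [← hs₁] at h1
  simp only [← hs₂] at h2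
  -- The cutoffs are changed one at a time, passing from `(φ₁, φ₁)` through `(φ₂, φ₁)` to `(φ₂,
  -- φ₂)`.
  simp only [_root_.add_apply, add_mul]
  rw [integral_add (integrable_mul_test μ s₁.continuous ψ)
    (integrable_mul_test μ s₂.continuous ψ)]
  simp only [mul_comm (s₁ _), mul_comm (s₂ _)]
  linear_combination h1 + h2

-- The issue is continuity in `ψ`. It is inherited by a pointwise limit: with `t = n + 1`, the part
-- `(φ - φ ∘ δ_t) f` of `φ f` is a test function `w n`, and the part `(φ ∘ δ_t) f` acts in the limit
-- as `f(φ)` times the delta at 0, which contributes `f(φ) φ g`.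
include hf hg in
theorem exists_convolution {φ : TestFn V} (hφ : ∀ᶠ x in 𝓝 (0 : V), φ x = 1) :
    ∃ k : Distr V, ∀ ψ : TestFn V, k ψ = G.convPair f φ g φ ψ := by
  have hn : ∀ n : ℕ, (0 : ℝ) < n + 1 := fun n => by positivity
  have hw : ∀ n : ℕ, ∃ w : TestFn V, ∀ h, ContDiff ℝ ∞ h →
      pair f (φ - G.compDilation φ (hn n)) h = ∫ x, w x * h x ∂μ := fun n => by
    obtain ⟨w, -, hw⟩ := hf.1.exists_testFn μ _
      (eventually_sub_eq_zero hφ (G.compDilation_eventually_eq_one hφ (hn n)))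
    exact ⟨w, hw⟩
  choose w hw using hw
  choose s hs using fun n => G.exists_testFn_pair_mul_neg μ hg hφ (w n)
  refine exists_of_tendsto (T := fun n => ofFun μ (s n) + f φ • cutoff φ g) fun ψ => ?_
  have hF := G.contDiff_pair_mul_left μ hg hφ ψ.contDiff
  have hval : ∀ n, (ofFun μ (s n) + f φ • cutoff φ g) ψ = G.convPair f φ g φ ψ -
      pair f φ (fun x => pair g φ fun y => ψ (G.mul (G.dilation ((n : ℝ) + 1)⁻¹ x) y)) +
        f φ * pair g φ ψ := by
    intro n
    have h1 := G.convPair_sub_left μ hg hφ (hw n) ψ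
    simp only [← hs] at h1
    rw [_root_.add_apply, ofFun_apply μ (s n).continuous, _root_.smul_apply, smul_eq_mul,
      cutoff_eq_pair]
    simp only [mul_comm (s n _), ← h1]
    congr 2
    rw [convPair, G.pair_compDilation hf.2 φ hF]
  simp only [hval]
  have hc : Continuous fun ε : ℝ => pair f φ (fun x => pair g φ fun y =>
      ψ (G.mul (G.dilation ε x) y)) :=
    f.continuous_pair φ (Φ := fun (ε : ℝ) x => pair g φ fun y => ψ (G.mul (G.dilation ε x) y))
      (hF.comp (G.contDiff_dilation contDiff_fst contDiff_snd))
  have hlim := (hc.tendsto 0).comp (tendsto_one_div_add_atTop_nhds_zero_nat (𝕜 := ℝ))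
  simp only [dilation_zero, LinearMap.zero_apply, G.zero_mul, pair_const] at hlim
  have := (tendsto_const_nhds (x := G.convPair f φ g φ ψ)).sub hlim |>.add
    (tendsto_const_nhds (x := f φ * pair g φ ψ))
  rw [mul_comm (f φ), sub_add_cancel] at this
  refine this.congr fun n => ?_
  simp only [Function.comp_apply, one_div, mul_comm (f φ)]

-- The test function demanded by `IsConvolution` always exists: the inner pairing is smooth in `x`,
-- and its support is compact because those of `ψ` and `φ` are.
include hg in
theorem isConvolution_iff {φ : TestFn V} (hφ : ∀ᶠ x in 𝓝 (0 : V), φ x = 1) (k : Distr V) :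
    G.IsConvolution (cutoff φ f) (cutoff φ g) k ↔ ∀ ψ : TestFn V, k ψ = G.convPair f φ g φ ψ := by
  have hcut : ∀ (x : V) (ψ : TestFn V), cutoff φ g (G.leftTranslate x ψ) =
      pair g φ fun y => ψ (G.mul x y) := fun x ψ => cutoff_eq_pair g φ _
  constructor
  · intro h ψ
    obtain ⟨F, hF, hk⟩ := h ψ
    rw [hk, cutoff_eq_pair, convPair]
    congr 1
    funext x
    rw [hF, hcut]
  · intro h ψ
    obtain ⟨F, hF⟩ := G.exists_testFn_pair_mul_left μ hg hφ ψ
    refine ⟨F, fun x => by rw [hF, hcut], ?_⟩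
    rw [h, cutoff_eq_pair, convPair]
    congr 1
    funext x
    rw [hF]

omit [FiniteDimensional ℝ V] [MeasurableSpace V] [BorelSpace V] in
theorem isCompactlySupported_of_convPair {φ : TestFn V} {k : Distr V}
    (hk : ∀ ψ : TestFn V, k ψ = G.convPair f φ g φ ψ) : k.IsCompactlySupported := by
  refine ⟨(fun p : V × V => G.mul p.1 p.2) '' (tsupport φ ×ˢ tsupport φ),
    (φ.hasCompactSupport.isCompact.prod φ.hasCompactSupport).image
      (G.continuous_mul_comp continuous_fst continuous_snd), fun ψ hψ => ?_⟩
  rw [hk]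
  refine G.convPair_eq_zero fun x y hx hy => ?_
  by_contra hne
  exact hψ (subset_tsupport _ hne) ⟨(x, y), ⟨subset_tsupport _ hx, subset_tsupport _ hy⟩, rfl⟩

end HomogeneousGroup

/-! ### Distributions given by functions on open sets. -/

namespace Distr

variable {V : Type*} [NormedAddCommGroup V] [NormedSpace ℝ V] [MeasurableSpace V] [BorelSpace V]
  [FiniteDimensional ℝ V] (μ : Measure V) [μ.IsAddHaarMeasure]

/-- Continuous functions that define the same distribution on an open set are equal there. -/
theorem eqOn_of_integral_eq {U : Set V} (hU : IsOpen U) {c d : V → ℂ} (hc : ContinuousOn c U)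
    (hd : ContinuousOn d U)
    (h : ∀ ψ : TestFn V, tsupport ψ ⊆ U → ∫ x, c x * ψ x ∂μ = ∫ x, d x * ψ x ∂μ) :
    EqOn c d U := by
  have hint : ∀ e : V → ℂ, ContinuousOn e U → ∀ ψ : TestFn V, tsupport ψ ⊆ U →
      Integrable (fun x => e x * ψ x) μ := by
    intro e he ψ hψ
    have := TestFunction.integrable_bilin (Ω := ⟨U, hU⟩)
      (ContinuousLinearMap.mul ℂ ℂ) (μ := μ) (φ := e)
      (he.locallyIntegrableOn hU.measurableSet) ⟨ψ, ψ.contDiff, ψ.hasCompactSupport, hψ⟩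
    simpa [mul_comm] using this
  have hae := hU.ae_eq_zero_of_integral_contDiff_smul_eq_zero (μ := μ) (f := fun x => c x - d x)
    ((hc.sub hd).locallyIntegrableOn hU.measurableSet) fun g hg hgc hgU => by
      have hsm : ContDiff ℝ ∞ fun x => (g x : ℂ) := Complex.ofRealCLM.contDiff.comp hg
      have hsub : tsupport (fun x => (g x : ℂ)) ⊆ tsupport g := by
        refine closure_mono fun x hx hgx => hx ?_
        simp only [hgx, Complex.ofReal_zero]
      let ψ : TestFn V := ⟨fun x => (g x : ℂ), hsm, hgc.of_isClosed_subset (isClosed_tsupport _) hsub,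
        fun _ _ => trivial⟩
      have hψU : tsupport ψ ⊆ U := hsub.trans hgU
      have h1 := h ψ hψU
      rw [← sub_eq_zero, ← integral_sub (hint c hc ψ hψU) (hint d hd ψ hψU)] at h1
      rw [← h1]
      refine integral_congr_ae (Eventually.of_forall fun x => ?_)
      change (g x : ℝ) • (c x - d x) = c x * (g x : ℂ) - d x * (g x : ℂ)
      rw [Complex.real_smul]
      ring
  refine Measure.eqOn_open_of_ae_eq (μ := μ) ?_ hU hc hd
  rw [EventuallyEq, ae_restrict_iff' hU.measurableSet]
  filter_upwards [hae] with x hx hxU using sub_eq_zero.1 (hx hxU)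

theorem RepresentedBy.eqOn {u : Distr V} {F F' : V → ℂ} (h : RepresentedBy μ u F)
    (h' : RepresentedBy μ u F') : EqOn F F' {0}ᶜ :=
  eqOn_of_integral_eq μ isOpen_compl_singleton h.1.continuousOn h'.1.continuousOn fun ψ hψ => by
    rw [← h.2 ψ hψ, ← h'.2 ψ hψ]

omit [NormedSpace ℝ V] [MeasurableSpace V] [BorelSpace V] [FiniteDimensional ℝ V] in
theorem exists_nat_closedBall_subset {s : Set V} (hs : IsClosed s) (h0 : (0 : V) ∉ s) :
    ∃ n : ℕ, s ⊆ (Metric.closedBall (0 : V) (1 / ((n : ℝ) + 1)))ᶜ := by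
  obtain ⟨ε, hε, hball⟩ := Metric.nhds_basis_closedBall.mem_iff.1 (hs.isOpen_compl.mem_nhds h0)
  obtain ⟨n, hn⟩ := exists_nat_one_div_lt hε
  exact ⟨n, fun x hx hxb => hball (Metric.closedBall_subset_closedBall hn.le hxb) hx⟩

/-- A distribution is regular if it is smooth outside of arbitrarily small balls. -/
theorem isRegular_of_closedBall {u : Distr V} (h : ∀ ε > 0, ∃ F : V → ℂ, ContDiff ℝ ∞ F ∧
      ∀ ψ : TestFn V, tsupport ψ ⊆ (Metric.closedBall 0 ε)ᶜ → u ψ = ∫ x, F x * ψ x ∂μ) :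
    u.IsRegular μ := by
  have hpos : ∀ n : ℕ, (0 : ℝ) < 1 / ((n : ℝ) + 1) := fun n => by positivity
  choose F hF hFu using fun n : ℕ => h _ (hpos n)
  set U : ℕ → Set V := fun n => (Metric.closedBall (0 : V) (1 / ((n : ℝ) + 1)))ᶜ with hU
  have hUo : ∀ n, IsOpen (U n) := fun n => Metric.isClosed_closedBall.isOpen_compl
  have hex : ∀ x : V, x ≠ 0 → ∃ n, x ∈ U n := by
    intro x hx
    obtain ⟨n, hn⟩ := exists_nat_closedBall_subset (isClosed_singleton (x := x))
      (fun h0 => hx (mem_singleton_iff.1 h0).symm)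
    exact ⟨n, hn rfl⟩
  -- Uniqueness of representing functions lets the local ones be glued on the complement of the
  -- origin.
  have hagree : ∀ m n, EqOn (F m) (F n) (U m ∩ U n) := fun m n =>
    eqOn_of_integral_eq μ ((hUo m).inter (hUo n)) (hF m).continuous.continuousOn
      (hF n).continuous.continuousOn fun ψ hψ => by
        rw [← hFu m ψ (hψ.trans inter_subset_left), ← hFu n ψ (hψ.trans inter_subset_right)]
  classical
  let H : V → ℂ := fun x => if hx : x ≠ 0 then F (hex x hx).choose x else 0
  have hH : ∀ n, EqOn H (F n) (U n) := by
    intro n x hxn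
    have hx : x ≠ 0 := by
      rintro rfl
      exact hxn (Metric.mem_closedBall_self (hpos n).le)
    simp only [H, dif_pos hx]
    exact hagree _ n ⟨(hex x hx).choose_spec, hxn⟩
  refine ⟨H, fun x hx => ?_, fun ψ hψ => ?_⟩
  · obtain ⟨n, hn⟩ := hex x hx
    have := (hF n).contDiffAt.congr_of_eventuallyEq (((hH n).eventuallyEq_of_mem ((hUo n).mem_nhds hn)))
    exact this.contDiffWithinAt
  · obtain ⟨n, hn⟩ := exists_nat_closedBall_subset (isClosed_tsupport ψ)
      (fun h0 => hψ h0 rfl)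
    rw [hFu n ψ hn]
    refine integral_congr_ae (Eventually.of_forall fun x => ?_)
    by_cases hx : x ∈ tsupport ψ
    · change F n x * ψ x = H x * ψ x
      rw [hH n (hn hx)]
    · simp [image_eq_zero_of_notMem_tsupport hx]

theorem RepresentedBy.integrable {u : Distr V} {F : V → ℂ} (hu : RepresentedBy μ u F) {ψ : TestFn V} (hψ : tsupport ψ ⊆ {0}ᶜ) :
    Integrable (fun x => F x * ψ x) μ := by
  have := TestFunction.integrable_bilin (Ω := ⟨{0}ᶜ, isOpen_compl_singleton⟩)
    (ContinuousLinearMap.mul ℂ ℂ) (μ := μ) (φ := F)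
    (hu.1.continuousOn.locallyIntegrableOn isOpen_compl_singleton.measurableSet)
    ⟨ψ, ψ.contDiff, ψ.hasCompactSupport, hψ⟩
  simpa [mul_comm] using this

theorem RepresentedBy.sub_smooth {u v : Distr V} {F c : V → ℂ} (hu : RepresentedBy μ u F)
    (hc : ContDiff ℝ ∞ c) (h : ∀ ψ : TestFn V, u ψ = v ψ + ∫ x, c x * ψ x ∂μ) :
    RepresentedBy μ v fun x => F x - c x := by
  refine ⟨hu.1.sub hc.contDiffOn, fun ψ hψ => ?_⟩
  have h1 := h ψ
  rw [hu.2 ψ hψ] at h1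
  simp only [sub_mul]
  rw [integral_sub (hu.integrable μ hψ) (integrable_mul_test μ hc.continuous ψ), h1, add_sub_cancel_right]

end Distr

/-! ### From homogeneity modulo test functions to exact homogeneity. -/

namespace HomogeneousGroup

open Distr

variable {V : Type*} [NormedAddCommGroup V] [NormedSpace ℝ V] (G : HomogeneousGroup V)
  [FiniteDimensional ℝ V] [MeasurableSpace V] [BorelSpace V] (μ : Measure V) [μ.IsAddHaarMeasure]

theorem integral_mul_compDilation (c : V → ℂ) {t : ℝ} (ht : 0 < t) (ψ : TestFn V) :
    ∫ x, c x * G.compDilation ψ ht x ∂μ =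
      ((t : ℂ) ^ G.homDim)⁻¹ * ∫ x, c (G.dilation t⁻¹ x) * ψ x ∂μ := by
  rw [← G.integral_comp_dilation μ ht]
  refine integral_congr_ae (Eventually.of_forall fun x => ?_)
  simp only [compDilation_apply, G.dilation_inv_dilation ht.ne']

-- The norms of `δ_t` are bounded by one `M` for `0 ≤ t ≤ 1`, so the `k`-th derivatives of all terms
-- are bounded by a constant times the summable weights `2 ^ (-Q i)`.
omit [MeasurableSpace V] [BorelSpace V] in
theorem contDiff_tsum_dilation (hQ : 0 < G.homDim) (s : TestFn V) :
    ContDiff ℝ ∞ fun x => ∑' i : ℕ, ((1 / 2 : ℂ) ^ G.homDim) ^ i * s (G.dilation ((1 / 2) ^ i) x) := by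
  obtain ⟨M, hM⟩ := G.exists_norm_dil_le
  have hbd : ∀ k : ℕ, ∃ C : ℝ, ∀ x, ‖iteratedFDeriv ℝ k s x‖ ≤ C := fun k =>
    (s.hasCompactSupport.iteratedFDeriv k).exists_bound_of_continuous
      (s.contDiff.continuous_iteratedFDeriv (m := k) (by exact_mod_cast le_top))
  choose C hC using hbd
  have hr0 : (0 : ℝ) ≤ (1 / 2 : ℝ) ^ G.homDim := by positivity
  have hr1 : (1 / 2 : ℝ) ^ G.homDim < 1 := pow_lt_one₀ (by norm_num) (by norm_num) hQ.ne'
  have hterm : ∀ i : ℕ, ContDiff ℝ ∞ fun x => s (G.dilation ((1 / 2) ^ i) x) := fun i =>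
    s.contDiff.comp (G.contDiff_dilation contDiff_const contDiff_id)
  refine contDiff_tsum (v := fun k i => ((1 / 2 : ℝ) ^ G.homDim) ^ i * (C k * M ^ k))
    (fun i => contDiff_const.mul (hterm i)) (fun k _ => ?_) (fun k i x _ => ?_)
  · exact (summable_geometric_of_lt_one hr0 hr1).mul_right _
  · have h1 : (fun x => ((1 / 2 : ℂ) ^ G.homDim) ^ i * s (G.dilation ((1 / 2) ^ i) x)) =
        ((1 / 2 : ℂ) ^ G.homDim) ^ i • fun x => s (G.dilation ((1 / 2) ^ i) x) := rfl
    have hk : ((k : ℕ∞) : ℕ∞ω) ≤ ∞ := by exact_mod_cast le_top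
    rw [h1, iteratedFDeriv_const_smul_apply ((hterm i).of_le hk).contDiffAt, norm_smul]
    have h2 : ‖((1 / 2 : ℂ) ^ G.homDim) ^ i‖ = ((1 / 2 : ℝ) ^ G.homDim) ^ i := by simp
    rw [h2]
    refine mul_le_mul_of_nonneg_left ?_ (by positivity)
    have h3 := ContinuousLinearMap.iteratedFDeriv_comp_right (G.dil ((1 / 2) ^ i)) s.contDiff x
      (i := k) hk
    change ‖iteratedFDeriv ℝ k (s ∘ G.dil ((1 / 2) ^ i)) x‖ ≤ _
    rw [h3]
    refine (ContinuousMultilinearMap.norm_compContinuousLinearMap_le _ _).trans ?_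
    rw [Finset.prod_const, Finset.card_univ, Fintype.card_fin]
    refine mul_le_mul (hC k _) (pow_le_pow_left₀ (norm_nonneg _) (hM _ ⟨by positivity, ?_⟩) _)
      (by positivity) ((norm_nonneg _).trans (hC k 0))
    exact pow_le_one₀ (by norm_num) (by norm_num)

/-- A distribution that is homogeneous of degree `-Q` up to test functions is the sum of a
homogeneous distribution and a smooth function. -/
theorem exists_homogeneous_add_smooth (hQ : 0 < G.homDim) (k : Distr V)
    (hk : ∀ (t : ℝ) (ht : 0 < t), ∃ s : TestFn V, ∀ ψ : TestFn V,
      k (G.compDilation ψ ht) - k ψ = ∫ x, s x * ψ x ∂μ) :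
    ∃ h : Distr V, G.IsHomogeneous (-(G.homDim : ℤ)) h ∧ ∃ c : V → ℂ, ContDiff ℝ ∞ c ∧
      ∀ ψ : TestFn V, k ψ = h ψ + ∫ x, c x * ψ x ∂μ := by
  obtain ⟨s, hs⟩ := hk 2 two_pos
  set q : ℂ := (1 / 2 : ℂ) ^ G.homDim with hq
  have hqn : ‖q‖ < 1 := by
    have : ‖q‖ = (1 / 2 : ℝ) ^ G.homDim := by simp [hq]
    rw [this]
    exact pow_lt_one₀ (by norm_num) (by norm_num) hQ.ne'
  -- `c` solves `c - 2^{-Q} c ∘ δ_{1/2} = s`, which is exactly what makes `k + c` invariant under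
  -- `δ_2`.
  set c : V → ℂ := fun x => ∑' i : ℕ, q ^ i * s (G.dilation ((1 / 2) ^ i) x) with hc
  have hcs : ContDiff ℝ ∞ c := G.contDiff_tsum_dilation hQ s
  have hsum : ∀ x, Summable fun i : ℕ => q ^ i * s (G.dilation ((1 / 2) ^ i) x) := by
    intro x
    obtain ⟨C, hC⟩ := s.hasCompactSupport.exists_bound_of_continuous s.continuous
    refine Summable.of_norm_bounded (g := fun i => ‖q‖ ^ i * C)
      ((summable_geometric_of_lt_one (norm_nonneg q) hqn).mul_right C) fun i => ?_
    rw [norm_mul, norm_pow]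
    exact mul_le_mul_of_nonneg_left (hC _) (by positivity)
  have hrec : ∀ x, q * c (G.dilation 2⁻¹ x) = c x - s x := by
    intro x
    have h1 := (hsum x).tsum_eq_zero_add
    simp only [pow_zero, one_mul, dilation_one] at h1
    rw [hc]
    simp only
    rw [h1, add_sub_cancel_left, ← tsum_mul_left]
    refine tsum_congr fun i => ?_
    rw [dilation_dilation, pow_succ', _root_.mul_assoc, pow_succ, one_div]
  set h : Distr V := k + ofFun μ c with hh
  have hhψ : ∀ ψ, h ψ = k ψ + ∫ x, c x * ψ x ∂μ := fun ψ => by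
    rw [hh, _root_.add_apply, ofFun_apply μ hcs.continuous]
  have h2 : ∀ ψ, h (G.compDilation ψ two_pos) = h ψ := by
    intro ψ
    rw [hhψ, hhψ, G.integral_mul_compDilation μ c two_pos, ← integral_const_mul]
    have e : ∀ x, (((2 : ℝ) : ℂ) ^ G.homDim)⁻¹ * (c (G.dilation 2⁻¹ x) * ψ x) =
        c x * ψ x - s x * ψ x := by
      intro x
      rw [← sub_mul, ← hrec x, hq, one_div, inv_pow]
      push_cast
      ring
    simp only [e]
    rw [integral_sub (integrable_mul_test μ hcs.continuous ψ)
      (integrable_mul_test μ s.continuous ψ), ← hs ψ]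
    ring
  refine ⟨h, fun t ht ψ => ?_, fun x => -c x, hcs.neg, fun ψ => ?_⟩
  · simp only [sub_self, zpow_zero, one_mul]
    obtain ⟨st, hst⟩ := hk t ht
    set σ : V → ℂ := fun x => st x + ((t : ℂ) ^ G.homDim)⁻¹ * c (G.dilation t⁻¹ x) - c x with hσ
    have hct : Continuous fun x => ((t : ℂ) ^ G.homDim)⁻¹ * c (G.dilation t⁻¹ x) :=
      continuous_const.mul (hcs.continuous.comp (G.dil t⁻¹).continuous)
    have hσc : Continuous σ := (st.continuous.add hct).sub hcs.continuous
    have hdiff : ∀ ψ, h (G.compDilation ψ ht) - h ψ = ∫ x, σ x * ψ x ∂μ := by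
      intro ψ
      rw [hhψ, hhψ, G.integral_mul_compDilation μ c ht, ← integral_const_mul]
      simp only [hσ, sub_mul, add_mul, _root_.mul_assoc]
      have hi := integrable_mul_test μ hct ψ
      simp only [_root_.mul_assoc] at hi
      have hi' : Integrable (fun x => st x * ψ x + ((t : ℂ) ^ G.homDim)⁻¹ *
          (c (G.dilation t⁻¹ x) * ψ x)) μ := (integrable_mul_test μ st.continuous ψ).add hi
      rw [integral_sub hi'
        (integrable_mul_test μ hcs.continuous ψ),
        integral_add (integrable_mul_test μ st.continuous ψ) hi, ← hst ψ]
      ring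
    have hcomm : ∀ ψ, G.compDilation (G.compDilation ψ two_pos) ht =
        G.compDilation (G.compDilation ψ ht) two_pos := by
      intro ψ
      ext x
      simp only [compDilation_apply, dilation_dilation, mul_comm]
    -- `σ` is the defect of `h` under `δ_t`. Since `δ_t` commutes with `δ_2` and `h` is invariant
    -- under `δ_2`, so is the distribution `σ`. Iterating gives `σ(x) = qⁿ σ(δ_{2^{-n}} x)`, which
    -- tends to `0` because `σ` is continuous at the origin and `|q| < 1`.
    have hσ2 : ∀ x, q * σ (G.dilation 2⁻¹ x) = σ x := by
      have hcont : Continuous fun x => q * σ (G.dilation 2⁻¹ x) :=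
        continuous_const.mul (hσc.comp (G.dil 2⁻¹).continuous)
      have := eqOn_of_integral_eq μ isOpen_univ hcont.continuousOn hσc.continuousOn
        fun ψ _ => by
          rw [← hdiff ψ, ← h2 ψ, ← h2 (G.compDilation ψ ht), ← hcomm, hdiff,
            G.integral_mul_compDilation μ σ two_pos, ← integral_const_mul]
          refine integral_congr_ae (Eventually.of_forall fun x => ?_)
          simp only [hq, one_div, inv_pow]
          push_cast
          ring
      exact fun x => this (mem_univ x)
    have hiter : ∀ (n : ℕ) x, q ^ n * σ (G.dilation ((1 / 2) ^ n) x) = σ x := by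
      intro n
      induction n with
      | zero => intro x; simp [dilation_one]
      | succ n ih =>
        intro x
        rw [← ih x, ← hσ2 (G.dilation ((1 / 2) ^ n) x), dilation_dilation, pow_succ, pow_succ',
          one_div]
        ring
    have hzero : ∀ x, σ x = 0 := by
      intro x
      have hc1 : Continuous fun ε : ℝ => σ (G.dilation ε x) :=
        hσc.comp (G.continuous_dilation continuous_id continuous_const)
      have hl := (hc1.tendsto 0).comp (tendsto_pow_atTop_nhds_zero_of_lt_one
        (r := (1 / 2 : ℝ)) (by norm_num) (by norm_num))
      have hl2 := (tendsto_pow_atTop_nhds_zero_of_norm_lt_one hqn).mul hl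
      rw [MulZeroClass.zero_mul] at hl2
      refine tendsto_nhds_unique (tendsto_const_nhds.congr fun n => ?_) hl2
      exact (hiter n x).symm
    have := hdiff ψ
    simp only [hzero, MulZeroClass.zero_mul, integral_zero] at this
    exact sub_eq_zero.1 this
  · rw [hhψ]
    simp only [_root_.neg_mul, integral_neg]
    ring

end HomogeneousGroup

namespace Distr

variable {V : Type*} [NormedAddCommGroup V] [NormedSpace ℝ V] [FiniteDimensional ℝ V]

variable (V) in
theorem exists_testFn_eventually_eq_one : ∃ φ : TestFn V, ∀ᶠ x in 𝓝 (0 : V), φ x = 1 := by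
  let b : ContDiffBump (0 : V) := default
  have hsm : ContDiff ℝ ∞ fun x => (b x : ℂ) := Complex.ofRealCLM.contDiff.comp b.contDiff
  refine ⟨⟨fun x => (b x : ℂ), hsm, b.hasCompactSupport.comp_left Complex.ofReal_zero,
    fun _ _ => trivial⟩, ?_⟩
  filter_upwards [b.eventuallyEq_one] with x hx
  change (b x : ℂ) = 1
  rw [hx]
  simp

variable [MeasurableSpace V] [BorelSpace V] (μ : Measure V) [μ.IsAddHaarMeasure]

theorem RepresentedBy.add {u v : Distr V} {F F' : V → ℂ} (hu : RepresentedBy μ u F)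
    (hv : RepresentedBy μ v F') : RepresentedBy μ (u + v) fun x => F x + F' x := by
  refine ⟨hu.1.add hv.1, fun ψ hψ => ?_⟩
  rw [_root_.add_apply, hu.2 ψ hψ, hv.2 ψ hψ,
    ← integral_add (hu.integrable μ hψ) (hv.integrable μ hψ)]
  simp only [add_mul]

omit [FiniteDimensional ℝ V] [BorelSpace V] [μ.IsAddHaarMeasure] in
theorem RepresentedBy.smul {u : Distr V} {F : V → ℂ} (hu : RepresentedBy μ u F) (c : ℂ) :
    RepresentedBy μ (c • u) fun x => c * F x := by
  refine ⟨contDiffOn_const.mul hu.1, fun ψ hψ => ?_⟩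
  rw [_root_.smul_apply, hu.2 ψ hψ, smul_eq_mul, ← integral_const_mul]
  simp only [_root_.mul_assoc]

end Distr

/-! ### Regularity of the convolution and uniqueness of the principal part. -/

namespace HomogeneousGroup

open Distr

variable {V : Type*} [NormedAddCommGroup V] [NormedSpace ℝ V] (G : HomogeneousGroup V)
  [FiniteDimensional ℝ V]

/-- There are cutoff functions with arbitrarily small supports. -/
theorem exists_cutoff_norm_mul_le {ε : ℝ} (hε : 0 < ε) :
    ∃ φ : TestFn V, (∀ᶠ x in 𝓝 (0 : V), φ x = 1) ∧
      ∀ x y, φ x ≠ 0 → φ y ≠ 0 → ‖G.mul x y‖ ≤ ε := by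
  obtain ⟨φ, hφ⟩ := exists_testFn_eventually_eq_one V
  obtain ⟨R, hR⟩ := ((φ.hasCompactSupport.isCompact.prod φ.hasCompactSupport.isCompact).image
    (G.continuous_mul_comp continuous_fst continuous_snd)).isBounded.exists_norm_le
  have hlim : Tendsto (fun t : ℝ => ‖G.dil t⁻¹‖ * R) atTop (𝓝 0) := by
    have h0 : G.dil 0 = 0 := by
      ext x
      simp [dilation_zero]
    have := ((G.continuous_dil.norm.tendsto 0).comp
      (tendsto_inv_atTop_zero : Tendsto (fun t : ℝ => t⁻¹) atTop (𝓝 0))).mul_const R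
    simpa [h0] using this
  obtain ⟨t, htε, ht⟩ := ((hlim.eventually_lt_const hε).and (eventually_gt_atTop 0)).exists
  refine ⟨G.compDilation φ ht, G.compDilation_eventually_eq_one hφ ht, fun x y hx hy => ?_⟩
  have h1 : ‖G.mul (G.dilation t x) (G.dilation t y)‖ ≤ R :=
    hR _ ⟨(_, _), ⟨subset_tsupport _ hx, subset_tsupport _ hy⟩, rfl⟩
  rw [← G.dilation_inv_dilation ht.ne' (G.mul x y), G.dilation_mul t]
  exact ((G.dil t⁻¹).le_opNorm _).trans
    ((mul_le_mul_of_nonneg_left h1 (norm_nonneg _)).trans htε.le)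

variable [MeasurableSpace V] [BorelSpace V] (μ : Measure V) [μ.IsAddHaarMeasure]

theorem isRegular_of_convPair {f g : Distr V} (hf : f ∈ G.symbolSpace μ)
    (hg : g ∈ G.symbolSpace μ) {φ : TestFn V} (hφ : ∀ᶠ x in 𝓝 (0 : V), φ x = 1) {k : Distr V}
    (hk : ∀ ψ : TestFn V, k ψ = G.convPair f φ g φ ψ) : k.IsRegular μ := by
  refine isRegular_of_closedBall μ fun ε hε => ?_
  -- With these cutoffs the convolution is supported in the `ε`-ball, so outside it the original
  -- convolution equals the test function by which the two differ.
  obtain ⟨φ', hφ', hsmall⟩ := G.exists_cutoff_norm_mul_le hε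
  obtain ⟨s, hs⟩ := G.exists_testFn_convPair_sub μ hf hg hφ hφ'
  refine ⟨s, s.contDiff, fun ψ hψ => ?_⟩
  rw [hk, ← hs ψ, G.convPair_eq_zero (φ := φ'), sub_zero]
  intro x y hx hy
  by_contra hne
  exact hψ (subset_tsupport _ hne) (mem_closedBall_zero_iff.2 (hsmall x y hx hy))

/-- The integral tends to `d 0 * ∫ ψ`, so the factor `t ^ (-Q)` wins. Hence continuous functions are
invisible to `ψ ∘ δ_t` as `t → ∞`, whereas distributions of degree `-Q` keep their value. -/
theorem tendsto_integral_compDilation (hQ : 0 < G.homDim) {d : V → ℂ} (hd : Continuous d)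
    (ψ : TestFn V) : Tendsto (fun t : ℝ => ((t : ℂ) ^ G.homDim)⁻¹ *
      ∫ x, d (G.dilation t⁻¹ x) * ψ x ∂μ) atTop (𝓝 0) := by
  have hc : Continuous fun ε : ℝ => ∫ x in tsupport ψ, d (G.dilation ε x) * ψ x ∂μ := by
    refine continuous_parametric_integral_of_continuous ?_ ψ.hasCompactSupport
    exact (hd.comp (G.continuous_dilation continuous_fst continuous_snd)).mul
      (ψ.continuous.comp continuous_snd)
  have he : ∀ ε : ℝ, ∫ x in tsupport ψ, d (G.dilation ε x) * ψ x ∂μ =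
      ∫ x, d (G.dilation ε x) * ψ x ∂μ := fun ε =>
    setIntegral_eq_integral_of_forall_compl_eq_zero fun x hx => by
      rw [image_eq_zero_of_notMem_tsupport hx, MulZeroClass.mul_zero]
  simp only [he] at hc
  have h1 := (hc.tendsto 0).comp (tendsto_inv_atTop_zero : Tendsto (fun t : ℝ => t⁻¹) atTop (𝓝 0))
  have h2 : Tendsto (fun t : ℝ => ((t : ℂ) ^ G.homDim)⁻¹) atTop (𝓝 0) := by
    have h3 := (tendsto_inv_atTop_zero.comp (tendsto_pow_atTop (α := ℝ) hQ.ne'))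
    have h4 := (Complex.continuous_ofReal.tendsto 0).comp h3
    rw [Complex.ofReal_zero] at h4
    exact h4.congr fun t => by simp
  simpa using h2.mul h1

/-- Two homogeneous distributions of degree `-Q` that differ by a continuous function are equal. -/
theorem eq_of_isHomogeneous_of_sub (hQ : 0 < G.homDim) {h h' : Distr V}
    (hh : G.IsHomogeneous (-(G.homDim : ℤ)) h) (hh' : G.IsHomogeneous (-(G.homDim : ℤ)) h')
    {d : V → ℂ} (hd : Continuous d) (hsub : ∀ ψ : TestFn V, h ψ - h' ψ = ∫ x, d x * ψ x ∂μ) :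
    h = h' := by
  ext ψ
  rw [← sub_eq_zero]
  refine tendsto_nhds_unique (tendsto_const_nhds.congr' ?_)
    (G.tendsto_integral_compDilation μ hQ hd ψ)
  filter_upwards [eventually_gt_atTop 0] with t ht
  have h1 := hsub (G.compDilation ψ ht)
  rw [hh t ht, hh' t ht, G.integral_mul_compDilation μ d ht] at h1
  simpa using h1

/-- This is the decay, on dilated test functions, of the term of degree `-Q + (m + 1)` in an
expansion, logarithm included. -/
theorem tendsto_zpow_neg_mul_log (m : ℕ) (A C : ℂ) :
    Tendsto (fun t : ℝ => (t : ℂ) ^ (-((m : ℤ) + 1)) * (A + (Real.log t : ℂ) * C)) atTop (𝓝 0) := by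
  have h1 : Tendsto (fun t : ℝ => ((t⁻¹ : ℝ) : ℂ)) atTop (𝓝 0) := by
    have := (Complex.continuous_ofReal.tendsto 0).comp tendsto_inv_atTop_zero
    rwa [Complex.ofReal_zero] at this
  have h2 : Tendsto (fun t : ℝ => ((Real.log t / t : ℝ) : ℂ)) atTop (𝓝 0) := by
    have := (Complex.continuous_ofReal.tendsto 0).comp
      Real.isLittleO_log_id_atTop.tendsto_div_nhds_zero
    rwa [Complex.ofReal_zero] at this
  have h3 := (h1.pow m).mul ((h1.mul_const A).add (h2.mul_const C))
  simp only [MulZeroClass.zero_mul, add_zero, MulZeroClass.mul_zero] at h3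
  refine h3.congr' ?_
  filter_upwards [eventually_gt_atTop 0] with t ht
  have ht' : (t : ℂ) ≠ 0 := by exact_mod_cast ht.ne'
  rw [zpow_neg, zpow_add₀ ht', zpow_natCast, zpow_one]
  simp only [Complex.ofReal_div, Complex.ofReal_inv, inv_pow]
  field_simp

/-- Uniqueness of the principal part. -/
theorem eq_of_hasPrincipalPart (hQ : 0 < G.homDim) {k h h' : Distr V}
    (hh : G.IsHomogeneous (-(G.homDim : ℤ)) h) {c : V → ℂ} (hc : Continuous c)
    (hk : ∀ ψ : TestFn V, k ψ = h ψ + ∫ x, c x * ψ x ∂μ) (hp : G.HasPrincipalPart μ k h') :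
    h' = h := by
  obtain ⟨-, -, a, rfl, hlog, hrem⟩ := hp
  obtain ⟨N, hN⟩ := hrem 0
  -- A continuous remainder is enough; taking `N + 1` terms guarantees that `a 0` is among them.
  obtain ⟨r, hr, hrψ⟩ := hN (N + 1) (Nat.le_succ N)
  have hrc : Continuous r := hr.continuous
  have ha0 : G.IsHomogeneous (-(G.homDim : ℤ)) (a 0) := by
    obtain ⟨-, p, hp, hpt, hap⟩ := hlog 0
    -- No logarithm occurs in degree `-Q`: `p(x) = t^Q p(δ_t x)`, which tends to `0` as `t → 0`.
    have hp0 : ∀ x, p x = 0 := by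
      intro x
      have hcp : Continuous fun t : ℝ => (t : ℂ) ^ G.homDim * p (G.dilation t x) :=
        (Complex.continuous_ofReal.pow _).mul
          (hp.continuous.comp (G.continuous_dilation continuous_id continuous_const))
      have hl := (hcp.tendsto 0).mono_left (nhdsWithin_le_nhds (s := Ioi (0 : ℝ)))
      simp only [Complex.ofReal_zero, zero_pow hQ.ne', MulZeroClass.zero_mul] at hl
      refine tendsto_nhds_unique (tendsto_const_nhds.congr' ?_) hl
      filter_upwards [self_mem_nhdsWithin] with t ht
      have ht' : (t : ℂ) ≠ 0 := by exact_mod_cast (ne_of_gt ht)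
      rw [hpt t ht, ← _root_.mul_assoc]
      simp [ht']
    intro t ht ψ
    rw [hap t ht ψ]
    simp [hp0]
  refine G.eq_of_isHomogeneous_of_sub μ hQ ha0 hh (d := 0) continuous_const fun ψ => ?_
  simp only [Pi.zero_apply, MulZeroClass.zero_mul, integral_zero]
  have hdiff : ∀ ψ, a 0 ψ - h ψ = ∫ x, (c x - r x) * ψ x ∂μ -
      ∑ j ∈ Finset.range N, a (j + 1) ψ := by
    intro ψ
    have h1 := hrψ ψ
    rw [Finset.sum_range_succ', hk] at h1
    simp only [sub_mul]
    rw [integral_sub (integrable_mul_test μ hc ψ) (integrable_mul_test μ hrc ψ)]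
    linear_combination -h1
  choose hreg p hp hpt hap using fun j => hlog (j + 1)
  have hlim := (G.tendsto_integral_compDilation μ hQ (hc.sub hrc) ψ).sub
    (tendsto_finsetSum (Finset.range N) fun j _ =>
      tendsto_zpow_neg_mul_log j (a (j + 1) ψ) (∫ x, p j x * ψ x ∂μ))
  simp only [Finset.sum_const_zero, sub_zero] at hlim
  refine tendsto_nhds_unique (tendsto_const_nhds.congr' ?_) hlim
  filter_upwards [eventually_gt_atTop 0] with t ht
  have h1 := hdiff (G.compDilation ψ ht)
  have h2 := ha0 t ht ψ
  have h3 := hh t ht ψ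
  simp only [sub_self, zpow_zero, one_mul] at h2 h3
  rw [h2, h3, G.integral_mul_compDilation μ (fun x => c x - r x) ht] at h1
  rw [h1]
  congr 1
  refine Finset.sum_congr rfl fun j _ => ?_
  rw [hap j t ht ψ]
  congr 2
  push_cast
  ring

/-- The expansion has the single nonzero term `h`, and `c` is the remainder as soon as at least one
term is subtracted. -/
theorem hasPrincipalPart_of_eq_add {k h : Distr V} (hkc : k.IsCompactlySupported)
    (hkr : k.IsRegular μ) (hh : h ∈ G.symbolSpace μ) {c : V → ℂ} (hc : ContDiff ℝ ∞ c)
    (hk : ∀ ψ : TestFn V, k ψ = h ψ + ∫ x, c x * ψ x ∂μ) : G.HasPrincipalPart μ k h := by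
  refine ⟨hkc, hkr, fun j => if j = 0 then h else 0, if_pos rfl, fun j => ?_, fun M => ⟨1, fun N hN =>
    ⟨c, hc.of_le (by exact_mod_cast le_top), fun ψ => ?_⟩⟩⟩
  · by_cases hj : j = 0
    · subst hj
      refine ⟨by simpa using hh.1, 0, contDiff_const, fun t _ x => by simp, fun t ht ψ => ?_⟩
      have := hh.2 t ht ψ
      simpa using this
    · simp only [hj, if_false]
      exact ⟨⟨0, contDiffOn_const, fun ψ _ => by simp⟩, 0, contDiff_const, fun t _ x => by simp,
        fun t ht ψ => by simp⟩
  · have : ∑ j ∈ Finset.range N, (if j = 0 then h else 0 : Distr V) ψ = h ψ := by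
      rw [Finset.sum_eq_single_of_mem 0 (Finset.mem_range.2 (by omega))
        (fun j _ hj => by simp [hj])]
      simp
    rw [this, hk, add_sub_cancel_left]

/-- The convolution of two symbols is a symbol up to a smooth function. -/
theorem exists_symbol_convPair (hQ : 0 < G.homDim) {f g : Distr V} (hf : f ∈ G.symbolSpace μ)
    (hg : g ∈ G.symbolSpace μ) {φ : TestFn V} (hφ : ∀ᶠ x in 𝓝 (0 : V), φ x = 1) :
    ∃ h ∈ G.symbolSpace μ, ∃ c : V → ℂ, ContDiff ℝ ∞ c ∧
      ∀ ψ : TestFn V, G.convPair f φ g φ ψ = h ψ + ∫ x, c x * ψ x ∂μ := by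
  obtain ⟨k, hk⟩ := G.exists_convolution μ hf hg hφ
  obtain ⟨h, hh, c, hc, hkc⟩ := G.exists_homogeneous_add_smooth μ hQ k fun t ht => by
    obtain ⟨s, hs⟩ := G.exists_testFn_convPair_sub μ hf hg
      (G.compDilation_eventually_eq_one hφ (inv_pos.2 ht)) hφ
    refine ⟨s, fun ψ => ?_⟩
    rw [hk, hk, G.convPair_compDilation μ hf hg hφ, hs]
  obtain ⟨F, hF⟩ := G.isRegular_of_convPair μ hf hg hφ hk
  exact ⟨h, ⟨⟨_, hF.sub_smooth μ hc hkc⟩, hh⟩, c, hc, fun ψ => by rw [← hk, hkc]⟩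

/-! ### The product of symbols. -/

/-- The relation between two symbols and their product. -/
def IsProductSymbol (f g h : Distr V) : Prop :=
  h ∈ G.symbolSpace μ ∧ ∀ φ : TestFn V, (∀ᶠ x in 𝓝 (0 : V), φ x = 1) →
    ∃ c : V → ℂ, ContDiff ℝ ∞ c ∧
      ∀ ψ : TestFn V, G.convPair f φ g φ ψ = h ψ + ∫ x, c x * ψ x ∂μ

theorem exists_isProductSymbol (hQ : 0 < G.homDim) {f g : Distr V} (hf : f ∈ G.symbolSpace μ)
    (hg : g ∈ G.symbolSpace μ) : ∃ h, G.IsProductSymbol μ f g h := by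
  obtain ⟨φ₀, hφ₀⟩ := exists_testFn_eventually_eq_one V
  obtain ⟨h, hh, c, hc, hconv⟩ := G.exists_symbol_convPair μ hQ hf hg hφ₀
  refine ⟨h, hh, fun φ hφ => ?_⟩
  obtain ⟨s, hs⟩ := G.exists_testFn_convPair_sub μ hf hg hφ hφ₀
  refine ⟨fun x => c x + s x, hc.add s.contDiff, fun ψ => ?_⟩
  simp only [add_mul]
  rw [integral_add (integrable_mul_test μ hc.continuous ψ)
    (integrable_mul_test μ s.continuous ψ), ← hs ψ, hconv ψ]
  ring

variable {G μ}

/-- Bilinearity of the product is deduced from this: the relation is compatible with sums and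
multiples in each factor, and it determines `h`. -/
theorem IsProductSymbol.unique (hQ : 0 < G.homDim) {f g h h' : Distr V}
    (hh : G.IsProductSymbol μ f g h) (hh' : G.IsProductSymbol μ f g h') : h = h' := by
  obtain ⟨φ, hφ⟩ := exists_testFn_eventually_eq_one V
  obtain ⟨c, hc, h1⟩ := hh.2 φ hφ
  obtain ⟨c', hc', h2⟩ := hh'.2 φ hφ
  refine G.eq_of_isHomogeneous_of_sub μ hQ hh.1.2 hh'.1.2 (d := fun x => c' x - c x)
    (hc'.continuous.sub hc.continuous) fun ψ => ?_
  simp only [sub_mul]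
  rw [integral_sub (integrable_mul_test μ hc'.continuous ψ)
    (integrable_mul_test μ hc.continuous ψ)]
  linear_combination h2 ψ - h1 ψ

theorem IsProductSymbol.add_left {f f' g h h' : Distr V} (hh : G.IsProductSymbol μ f g h)
    (hh' : G.IsProductSymbol μ f' g h') : G.IsProductSymbol μ (f + f') g (h + h') := by
  refine ⟨add_mem hh.1 hh'.1, fun φ hφ => ?_⟩
  obtain ⟨c, hc, h1⟩ := hh.2 φ hφ
  obtain ⟨c', hc', h2⟩ := hh'.2 φ hφ
  refine ⟨fun x => c x + c' x, hc.add hc', fun ψ => ?_⟩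
  simp only [add_mul]
  rw [integral_add (integrable_mul_test μ hc.continuous ψ)
    (integrable_mul_test μ hc'.continuous ψ)]
  have : G.convPair (f + f') φ g φ ψ = G.convPair f φ g φ ψ + G.convPair f' φ g φ ψ := rfl
  rw [this, h1, h2, _root_.add_apply]
  ring

theorem IsProductSymbol.smul_left {f g h : Distr V} (hh : G.IsProductSymbol μ f g h) (a : ℂ) :
    G.IsProductSymbol μ (a • f) g (a • h) := by
  refine ⟨Submodule.smul_mem _ a hh.1, fun φ hφ => ?_⟩
  obtain ⟨c, hc, h1⟩ := hh.2 φ hφ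
  refine ⟨fun x => a * c x, contDiff_const.mul hc, fun ψ => ?_⟩
  have : G.convPair (a • f) φ g φ ψ = a * G.convPair f φ g φ ψ := rfl
  simp only [_root_.mul_assoc]
  rw [this, h1, integral_const_mul, _root_.smul_apply, smul_eq_mul, mul_add]

theorem IsProductSymbol.add_right {f g g' h h' : Distr V} (hg : g ∈ G.symbolSpace μ)
    (hg' : g' ∈ G.symbolSpace μ) (hh : G.IsProductSymbol μ f g h)
    (hh' : G.IsProductSymbol μ f g' h') : G.IsProductSymbol μ f (g + g') (h + h') := by
  refine ⟨add_mem hh.1 hh'.1, fun φ hφ => ?_⟩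
  obtain ⟨c, hc, h1⟩ := hh.2 φ hφ
  obtain ⟨c', hc', h2⟩ := hh'.2 φ hφ
  refine ⟨fun x => c x + c' x, hc.add hc', fun ψ => ?_⟩
  simp only [add_mul]
  rw [integral_add (integrable_mul_test μ hc.continuous ψ)
    (integrable_mul_test μ hc'.continuous ψ)]
  have : G.convPair f φ (g + g') φ ψ = G.convPair f φ g φ ψ + G.convPair f φ g' φ ψ :=
    pair_add f φ (G.contDiff_pair_mul_left μ hg hφ ψ.contDiff)
      (G.contDiff_pair_mul_left μ hg' hφ ψ.contDiff)
  rw [this, h1, h2, _root_.add_apply]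
  ring

theorem IsProductSymbol.smul_right {f g h : Distr V} (hg : g ∈ G.symbolSpace μ)
    (hh : G.IsProductSymbol μ f g h) (a : ℂ) : G.IsProductSymbol μ f (a • g) (a • h) := by
  refine ⟨Submodule.smul_mem _ a hh.1, fun φ hφ => ?_⟩
  obtain ⟨c, hc, h1⟩ := hh.2 φ hφ
  refine ⟨fun x => a * c x, contDiff_const.mul hc, fun ψ => ?_⟩
  have : G.convPair f φ (a • g) φ ψ = a * G.convPair f φ g φ ψ :=
    pair_const_mul f φ a (G.contDiff_pair_mul_left μ hg hφ ψ.contDiff)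
  simp only [_root_.mul_assoc]
  rw [this, h1, integral_const_mul, _root_.smul_apply, smul_eq_mul, mul_add]

theorem IsProductSymbol.isSymbolProduct_iff (hQ : 0 < G.homDim) {f g h : Distr V}
    (hf : f ∈ G.symbolSpace μ) (hg : g ∈ G.symbolSpace μ) (hh : G.IsProductSymbol μ f g h)
    {φ : TestFn V} (hφ : ∀ᶠ x in 𝓝 (0 : V), φ x = 1) (h' : Distr V) :
    G.IsSymbolProduct μ φ f g h' ↔ h' = h := by
  obtain ⟨c, hc, hconv⟩ := hh.2 φ hφ
  constructor
  · rintro ⟨k, hk, hp⟩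
    rw [G.isConvolution_iff μ hg hφ] at hk
    exact G.eq_of_hasPrincipalPart μ hQ hh.1.2 hc.continuous
      (fun ψ => by rw [hk, hconv]) hp
  · rintro rfl
    obtain ⟨k, hk⟩ := G.exists_convolution μ hf hg hφ
    exact ⟨k, (G.isConvolution_iff μ hg hφ k).2 hk, G.hasPrincipalPart_of_eq_add μ
      (G.isCompactlySupported_of_convPair hk) (G.isRegular_of_convPair μ hf hg hφ hk) hh.1 hc
      fun ψ => by rw [hk, hconv]⟩

/-! ### The trace property. -/

theorem _root_.Distr.RepresentedBy.dilation {h : Distr V}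
    (hh : G.IsHomogeneous (-(G.homDim : ℤ)) h) {H : V → ℂ} (hH : RepresentedBy μ h H) {t : ℝ}
    (ht : 0 < t) {x : V} (hx : x ≠ 0) :
    ((t : ℂ) ^ G.homDim)⁻¹ * H (G.dilation t⁻¹ x) = H x := by
  have hmaps : MapsTo (G.dil t⁻¹) {0}ᶜ {0}ᶜ := fun y hy h0 =>
    hy ((G.dilation_injective (inv_pos.2 ht)) (by simpa using h0))
  refine eqOn_of_integral_eq μ isOpen_compl_singleton (c := fun x =>
    ((t : ℂ) ^ G.homDim)⁻¹ * H (G.dilation t⁻¹ x)) (d := H) (continuousOn_const.mul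
    (hH.1.continuousOn.comp (G.dil t⁻¹).continuous.continuousOn hmaps)) hH.1.continuousOn
    (fun ψ hψ => ?_) hx
  have hψt : tsupport (G.compDilation ψ ht) ⊆ {0}ᶜ := by
    intro y hy h0
    rw [mem_singleton_iff] at h0
    subst h0
    have h1 : ∀ᶠ x in 𝓝 (0 : V), ψ x = 0 :=
      notMem_tsupport_iff_eventuallyEq.1 fun h0 => hψ h0 rfl
    have h2 : Tendsto (G.dil t) (𝓝 0) (𝓝 0) := by
      simpa using (G.dil t).continuous.tendsto 0
    exact notMem_tsupport_iff_eventuallyEq.2 (h2.eventually h1) hy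
  have h1 := hh t ht ψ
  rw [hH.2 ψ hψ, hH.2 _ hψt, G.integral_mul_compDilation μ H ht] at h1
  simp only [sub_self, zpow_zero, one_mul] at h1
  rw [← h1, ← integral_const_mul]
  simp only [_root_.mul_assoc]

/-- Away from the origin, the two convolutions of compactly supported symbols agree at central
elements. -/
theorem eq_of_isCentral {f g : Distr V} (hf : f ∈ G.symbolSpace μ) (hg : g ∈ G.symbolSpace μ)
    {φ : TestFn V} (hφ : ∀ᶠ x in 𝓝 (0 : V), φ x = 1) {z : V} (hz : G.IsCentral z) (hz0 : z ≠ 0)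
    {F F' : V → ℂ} (hF : ContinuousOn F {0}ᶜ) (hF' : ContinuousOn F' {0}ᶜ)
    (hFc : ∀ ψ : TestFn V, tsupport ψ ⊆ {0}ᶜ → G.convPair f φ g φ ψ = ∫ x, F x * ψ x ∂μ)
    (hFc' : ∀ ψ : TestFn V, tsupport ψ ⊆ {0}ᶜ → G.convPair g φ f φ ψ = ∫ x, F' x * ψ x ∂μ) :
    F z = F' z := by
  have hε : 0 < ‖z‖ / 2 := by positivity
  -- The convolutions with cutoff `φ'` live in the ball of radius `‖z‖ / 2` and vanish near `z`.
  obtain ⟨φ', hφ', hsmall⟩ := G.exists_cutoff_norm_mul_le hε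
  obtain ⟨w, -, hw⟩ := hf.1.exists_testFn μ _ (eventually_sub_eq_zero hφ hφ')
  obtain ⟨w', -, hw'⟩ := hg.1.exists_testFn μ _ (eventually_sub_eq_zero hφ hφ')
  obtain ⟨s₁, hs₁⟩ := G.exists_testFn_pair_mul_neg μ hg hφ w
  obtain ⟨s₂, hs₂⟩ := G.exists_testFn_pair_neg_mul μ hf hφ' w'
  obtain ⟨s₃, hs₃⟩ := G.exists_testFn_pair_neg_mul μ hg hφ w
  obtain ⟨s₄, hs₄⟩ := G.exists_testFn_pair_mul_neg μ hf hφ' w'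
  set U : Set V := (Metric.closedBall (0 : V) (‖z‖ / 2))ᶜ with hU
  have hUo : IsOpen U := Metric.isClosed_closedBall.isOpen_compl
  have hU0 : U ⊆ {0}ᶜ := fun x hx h0 => by
    rw [mem_singleton_iff] at h0
    subst h0
    exact hx (Metric.mem_closedBall_self hε.le)
  have hzU : z ∈ U := by
    simp only [hU, mem_compl_iff, mem_closedBall_zero_iff, not_le]
    linarith
  have hvanish : ∀ (u v : Distr V) (ψ : TestFn V), tsupport ψ ⊆ U → G.convPair u φ' v φ' ψ = 0 := by
    intro u v ψ hψ
    refine G.convPair_eq_zero fun x y hx hy => ?_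
    by_contra hne
    exact hψ (subset_tsupport _ hne) (mem_closedBall_zero_iff.2 (hsmall x y hx hy))
  have hsum : ∀ (s s' : TestFn V) (ψ : TestFn V), ∫ x, (s x + s' x) * ψ x ∂μ =
      ∫ x, ψ x * s x ∂μ + ∫ x, ψ x * s' x ∂μ := by
    intro s s' ψ
    simp only [add_mul]
    rw [integral_add (integrable_mul_test μ s.continuous ψ)
      (integrable_mul_test μ s'.continuous ψ)]
    simp only [mul_comm]
  have e1 : EqOn F (fun x => s₁ x + s₂ x) U := by
    refine eqOn_of_integral_eq μ hUo (hF.mono hU0)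
      (s₁.continuous.add s₂.continuous).continuousOn fun ψ hψ => ?_
    have h1 := G.convPair_sub_left μ hg hφ hw ψ
    have h2 := G.convPair_sub_right μ hf hg hφ' hφ hφ' hw' ψ
    simp only [← hs₁] at h1
    simp only [← hs₂] at h2
    rw [← hFc ψ (hψ.trans hU0), hsum]
    linear_combination h1 + h2 + hvanish f g ψ hψ
  -- In both orders the cutoff of `f` is changed before that of `g`, so here the right factor goes
  -- first. Thus `w` is paired with `φ g` and `w'` with `φ' f` in both cases, and the results differ
  -- only in the side on which the inverted variable stands.
  have e2 : EqOn F' (fun x => s₃ x + s₄ x) U := by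
    refine eqOn_of_integral_eq μ hUo (hF'.mono hU0)
      (s₃.continuous.add s₄.continuous).continuousOn fun ψ hψ => ?_
    have h1 := G.convPair_sub_right μ hg hf hφ hφ hφ' hw ψ
    have h2 := G.convPair_sub_left μ hf hφ' hw' ψ
    simp only [← hs₃] at h1
    simp only [← hs₄] at h2
    rw [← hFc' ψ (hψ.trans hU0), hsum]
    linear_combination h1 + h2 + hvanish g f ψ hψ
  rw [e1 hzU, e2 hzU]
  simp only [hs₁, hs₂, hs₃, hs₄, hz _]

/-- The trace property. -/
theorem IsProductSymbol.apply_eq_of_isCentral (hQ : 0 < G.homDim) {f g h h' : Distr V}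
    (hf : f ∈ G.symbolSpace μ) (hg : g ∈ G.symbolSpace μ) (hh : G.IsProductSymbol μ f g h)
    (hh' : G.IsProductSymbol μ g f h') {z : V} (hz : G.IsCentral z) (hz0 : z ≠ 0) {H H' : V → ℂ}
    (hH : RepresentedBy μ h H) (hH' : RepresentedBy μ h' H') : H z = H' z := by
  obtain ⟨φ, hφ⟩ := exists_testFn_eventually_eq_one V
  obtain ⟨c, hc, hconv⟩ := hh.2 φ hφ
  obtain ⟨c', hc', hconv'⟩ := hh'.2 φ hφ
  have hrep : ∀ {u : Distr V} {H c : V → ℂ}, RepresentedBy μ u H → ContDiff ℝ ∞ c →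
      ∀ ψ : TestFn V, tsupport ψ ⊆ {0}ᶜ →
        u ψ + ∫ x, c x * ψ x ∂μ = ∫ x, (H x + c x) * ψ x ∂μ := by
    intro u H c hH hc ψ hψ
    simp only [add_mul]
    rw [integral_add (hH.integrable μ hψ) (integrable_mul_test μ hc.continuous ψ), hH.2 ψ hψ]
  -- At the central point `δ_{1/t} z` the functions `H + c` and `H' + c'` agree; homogeneity of `H`
  -- and `H'` carries this back to `z` with the factor `t ^ (-Q)`.
  have key : ∀ t : ℝ, 0 < t → H z - H' z = ((t : ℂ) ^ G.homDim)⁻¹ *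
      (c' (G.dilation t⁻¹ z) - c (G.dilation t⁻¹ z)) := by
    intro t ht
    have hne : G.dilation t⁻¹ z ≠ 0 := fun h0 =>
      hz0 (G.dilation_injective (inv_pos.2 ht) (by rw [h0, map_zero]))
    have h1 := G.eq_of_isCentral hf hg hφ (G.isCentral_dilation hz (inv_pos.2 ht).ne') hne
      (hH.1.continuousOn.add hc.continuous.continuousOn)
      (hH'.1.continuousOn.add hc'.continuous.continuousOn)
      (fun ψ hψ => by rw [hconv]; exact hrep hH hc ψ hψ)
      (fun ψ hψ => by rw [hconv']; exact hrep hH' hc' ψ hψ)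
    rw [← hH.dilation hh.1.2 ht hz0, ← hH'.dilation hh'.1.2 ht hz0, ← mul_sub]
    congr 1
    simp only [Pi.add_apply] at h1
    linear_combination h1
  have hcont : Continuous fun ε : ℝ => (ε : ℂ) ^ G.homDim *
      (c' (G.dilation ε z) - c (G.dilation ε z)) :=
    (Complex.continuous_ofReal.pow _).mul
      ((hc'.continuous.comp (G.continuous_dilation continuous_id continuous_const)).sub
        (hc.continuous.comp (G.continuous_dilation continuous_id continuous_const)))
  have hl := (hcont.tendsto 0).mono_left (nhdsWithin_le_nhds (s := Ioi (0 : ℝ)))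
  simp only [Complex.ofReal_zero, zero_pow hQ.ne', MulZeroClass.zero_mul] at hl
  refine sub_eq_zero.1 (tendsto_nhds_unique (tendsto_const_nhds.congr' ?_) hl)
  filter_upwards [self_mem_nhdsWithin] with t ht
  have := key t⁻¹ (inv_pos.2 ht)
  rw [inv_inv] at this
  rw [this]
  simp

end HomogeneousGroup

namespace HomogeneousGroup

open Distr

variable {V : Type*} [NormedAddCommGroup V] [NormedSpace ℝ V] [FiniteDimensional ℝ V]
  [MeasurableSpace V] [BorelSpace V] (μ : Measure V) [μ.IsAddHaarMeasure] (G : HomogeneousGroup V)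

/-- The product of principal symbols, as a bilinear map. -/
theorem exists_symbolMul (hQ : 0 < G.homDim) :
    ∃ mul : G.symbolSpace μ →ₗ[ℂ] G.symbolSpace μ →ₗ[ℂ] G.symbolSpace μ,
      ∀ f g : G.symbolSpace μ, G.IsProductSymbol μ f g (mul f g) := by
  choose m hm using fun f g : G.symbolSpace μ => G.exists_isProductSymbol μ hQ f.2 g.2
  exact ⟨LinearMap.mk₂ ℂ (fun f g => ⟨m f g, (hm f g).1⟩)
    (fun f f' g => Subtype.ext ((hm _ _).unique hQ ((hm f g).add_left (hm f' g))))
    (fun a f g => Subtype.ext ((hm _ _).unique hQ ((hm f g).smul_left a)))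
    (fun f g g' => Subtype.ext ((hm _ _).unique hQ ((hm f g).add_right g.2 g'.2 (hm f g'))))
    (fun a f g => Subtype.ext ((hm _ _).unique hQ ((hm f g).smul_right g.2 a))), hm⟩

/-- Evaluation of principal symbols at a point other than the origin. -/
theorem exists_symbolEval {z : V} (hz : z ≠ 0) :
    ∃ τ : G.symbolSpace μ →ₗ[ℂ] ℂ, ∀ (f : G.symbolSpace μ) (F : V → ℂ),
      RepresentedBy μ (f : Distr V) F → τ f = F z := by
  choose F hF using fun f : G.symbolSpace μ => f.2.1
  exact ⟨{
    toFun := fun f => F f z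
    map_add' := fun f g =>
      (hF (f + g)).eqOn μ ((hF f).add μ (hF g)) hz
    map_smul' := fun a f =>
      (hF (a • f)).eqOn μ ((hF f).smul μ a) hz }, fun f F' h => (hF f).eqOn μ h hz⟩

end HomogeneousGroup

end

theorem mainTheorem3 {V : Type*} [NormedAddCommGroup V] [NormedSpace ℝ V] [FiniteDimensional ℝ V]
    [MeasurableSpace V] [BorelSpace V] (μ : Measure V) [μ.IsAddHaarMeasure]
    (G : HomogeneousGroup V) (z : V) (hz : G.IsCentral z) (hz0 : z ≠ 0) :
    ∃ mul : G.symbolSpace μ →ₗ[ℂ] G.symbolSpace μ →ₗ[ℂ] G.symbolSpace μ,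
      (∀ φ : TestFn V, (∀ᶠ x in 𝓝 (0 : V), φ x = 1) →
        ∀ (f g : G.symbolSpace μ) (h : Distr V),
          G.IsSymbolProduct μ φ f g h ↔ h = mul f g) ∧
      ∃ τ : G.symbolSpace μ →ₗ[ℂ] ℂ,
        (∀ (f : G.symbolSpace μ) (F : V → ℂ), Distr.RepresentedBy μ (f : Distr V) F → τ f = F z) ∧
        ∀ f g : G.symbolSpace μ, τ (mul f g) = τ (mul g f) := by
  have hQ := G.homDim_pos hz0
  obtain ⟨mul, hmul⟩ := G.exists_symbolMul μ hQ
  obtain ⟨τ, hτ⟩ := G.exists_symbolEval μ hz0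
  refine ⟨mul, fun φ hφ f g h => (hmul f g).isSymbolProduct_iff hQ f.2 g.2 hφ h, τ, hτ,
    fun f g => ?_⟩
  obtain ⟨H, hH⟩ := (mul f g).2.1
  obtain ⟨H', hH'⟩ := (mul g f).2.1
  rw [hτ _ H hH, hτ _ H' hH']
  exact (hmul f g).apply_eq_of_isCentral hQ f.2 g.2 (hmul g f) hz hz0 hH hH'
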